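/- A finite hypergraph $\mathrm{H}\Gamma=(E^0,E^1,r,s)$ consists of finite sets $E^0$ (vertices) and $E^1$ (edges) and maps $r:E^1\to\mathcal P(E^0)$ (range) and $s:E^1\to\mathcal P(E^0)\setminus\{\emptyset\}$ (source). Hypergraphs are considered up to renaming vertices and edges. $C^*(\mathrm{H}\Gamma)$ is the universal $C^*$-algebra generated by pairwise orthogonal projections $p_v$ ($v\in E^0$) and partial isometries $s_e$ ($e\in E^1$) such that: $s_e^*s_f=0$ for $e\ne f$; $s_e^*s_e=\sum_{v\in r(e)}p_v$ if $r(e)\neq\emptyset$ and $s_e^*s_e=s_e$ if $r(e)=\emptyset$; $s_es_e^*\le\sum_{v\in s(e)}p_v$; and $p_v\le\sum_{e:\,v\in s(e)}s_es_e^*$ whenever $v\in s(e)$ for some $e$. Consider the following operations on a hypergraph; data not mentioned are unchanged. - Vertex deletion of $v$: remove $v$ and all edges $e$ with $s(e)=\{v\}$, and remove $v$ from all other ranges and sources. - Edge deletion of $f$: remove $f$. It is called trivial if $r(f)=\emptyset$ and $s(e)\cap s(f)=\emptyset$ for all $e\ne f$. - Forward contraction of $f$, where $s(f)=\{w\}$,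 no edge $e\neq f$ satisfies $s(e)\cap s(f)\ne\emptyset$, and no edge $e$ satisfies both $w\in r(e)$ and $r(e)\cap r(f)\neq\emptyset$: remove $w$ and $f$, and replace $r(e)$ by $(r(e)\setminus\{w\})\cup r(f)$ whenever $w\in r(e)$. - Backward contraction of $f$, where $r(f)=\{w\}$, no edge $e\neq f$ satisfies $s(e)\cap s(f)\ne\emptyset$, and no edge $e$ satisfies both $w\in r(e)$ and $r(e)\cap s(f)\neq\emptyset$: remove $w$ and $f$, replace $r(e)$ by $(r(e)\setminus\{w\})\cup s(f)$ whenever $w\in r(e)$, and $s(e)$ by $(s(e)\setminus\{w\})\cup s(f)$ whenever $w\in s(e)$. - Edge cutting of $f$: replace $r(f)$ by $\emptyset$. - Source separation of $F$ at a vertex $w$, where $\emptyset\ne F\subsetneq\{e: w\in s(e)\}$: add a new vertex $w'$, add $w'$ to every range that contains $w$, and replace $s(e)$ by $(s(e)\setminus\{w\})\cup\{w'\}$ for $e\in F$. - Range decomposition of an edge $f$ with $r(f)\neq\emptyset$: replace $f$ by edges $(f,v)$, $v\in r(f)$, with source $s(f)$ and range $\{v\}$. $\mathrm{H}\Delta$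 is a minor of $\mathrm{H}\Gamma$, written $\mathrm{H}\Delta\le\mathrm{H}\Gamma$, if it is obtained from $\mathrm{H}\Gamma$ by finitely many (possibly zero) of these operations. A hypergraph is normal if (1) $|r(e)|\le1$ for all edges $e$; (2) for every edge $e$, there is an edge $f\neq e$ with $s(e)\cap s(f)\ne\emptyset$, or $\emptyset\neq r(e)\subseteq s(e)$; (3) whenever $e\ne f$ are edges with $|s(e)\cap s(f)|=1$, then $|s(e)|=|s(f)|=1$, or there is an edge $g\ne e$ with $s(e)\cap s(f)\subsetneq s(e)\cap s(g)$. **Lemma 4.2.** For every finite hypergraph $\mathrm{H}\Gamma$ there is a normal minor $\mathrm{H}\Delta\le\mathrm{H}\Gamma$ such that $C^*(\mathrm{H}\Delta)$ is (strongly) Morita equivalent to $C^*(\mathrm{H}\Gamma)$. Moreover, $\mathrm{H}\Delta$ can be obtained from $\mathrm{H}\Gamma$ by a finite sequence of source separations, backward contractions, range decompositions and trivial edge deletions. -/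

import Mathlib

universe u v w

/-- A finite hypergraph: finite sets of vertices and edges; every edge has a (possibly empty)
range and a non-empty source, both of them sets of vertices. -/
structure FiniteHypergraph : Type (u + 1) where
  /-- the vertices -/
  V : Type u
  /-- the edges -/
  E : Type u
  finiteV : Finite V
  finiteE : Finite E
  range : E → Set V
  source : E → Set V
  source_nonempty : ∀ e, (source e).Nonempty

attribute [instance] FiniteHypergraph.finiteV FiniteHypergraph.finiteE

/-- The order of a C*-algebra: `a ≤ b` iff `b - a` is positive, that is, of the form `c* c`. -/
def CStarLE {B : Type v} [NonUnitalCStarAlgebra B] (a b : B) : Prop :=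
  ∃ c : B, b - a = star c * c

theorem cstarLE_iff_le {B : Type v} [NonUnitalCStarAlgebra B] [PartialOrder B] [StarOrderedRing B]
    (a b : B) : CStarLE a b ↔ a ≤ b := by
  rw [← sub_nonneg, CStarAlgebra.nonneg_iff_eq_star_mul_self]; rfl

namespace FiniteHypergraph

/-! ### The C*-algebra of a finite hypergraph -/

/-- Pairwise orthogonal projections `p v` and partial isometries `s e` in a C*-algebra that satisfy
the hypergraph relations. -/
structure Family (Γ : FiniteHypergraph.{u}) (B : Type v) [NonUnitalCStarAlgebra B] where
  p : Γ.V → B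
  s : Γ.E → B
  isStarProjection_p : ∀ v, IsStarProjection (p v)
  orthogonal_p : ∀ v w, v ≠ w → p v * p w = 0
  partialIsometry_s : ∀ e, s e * star (s e) * s e = s e
  star_mul_self_of_nonempty : ∀ e, (Γ.range e).Nonempty →
    star (s e) * s e = ∑ᶠ v ∈ Γ.range e, p v
  star_mul_self_of_empty : ∀ e, Γ.range e = ∅ → star (s e) * s e = s e
  star_mul_of_ne : ∀ e f, e ≠ f → star (s e) * s f = 0
  mul_star_le : ∀ e, CStarLE (s e * star (s e)) (∑ᶠ v ∈ Γ.source e, p v)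
  le_sum_mul_star : ∀ v, (∃ e, v ∈ Γ.source e) →
    CStarLE (p v) (∑ᶠ e ∈ {e | v ∈ Γ.source e}, s e * star (s e))

/-- The image of a family under a *-homomorphism. -/
def Family.map {Γ : FiniteHypergraph.{u}} {B : Type v} {C : Type w} [NonUnitalCStarAlgebra B]
    [NonUnitalCStarAlgebra C] (F : Family Γ B) (φ : B →⋆ₙₐ[ℂ] C) : Family Γ C where
  p v := φ (F.p v)
  s e := φ (F.s e)
  isStarProjection_p v := (F.isStarProjection_p v).map φ
  orthogonal_p v w h := by rw [← map_mul, F.orthogonal_p v w h, map_zero]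
  partialIsometry_s e := by rw [← map_star, ← map_mul, ← map_mul, F.partialIsometry_s]
  star_mul_self_of_nonempty e h := by
    rw [← map_star, ← map_mul, F.star_mul_self_of_nonempty e h]
    exact (φ : B →+ C).map_finsum_mem _ (Set.toFinite _)
  star_mul_self_of_empty e h := by
    rw [← map_star, ← map_mul, F.star_mul_self_of_empty e h]
  star_mul_of_ne e f h := by rw [← map_star, ← map_mul, F.star_mul_of_ne e f h, map_zero]
  mul_star_le e := by
    obtain ⟨c, hc⟩ := F.mul_star_le e
    refine ⟨φ c, ?_⟩
    rw [← map_star, ← map_mul, ← map_star, ← map_mul, ← hc, map_sub]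
    congr 1
    exact ((φ : B →+ C).map_finsum_mem _ (Set.toFinite _)).symm
  le_sum_mul_star v h := by
    obtain ⟨c, hc⟩ := F.le_sum_mul_star v h
    refine ⟨φ c, ?_⟩
    rw [← map_star, ← map_mul, ← hc, map_sub]
    congr 1
    simp only [← map_star, ← map_mul]
    exact ((φ : B →+ C).map_finsum_mem _ (Set.toFinite _)).symm

/-- All families of `Γ` in C*-algebras (of the universe of `Γ`). -/
structure Rep (Γ : FiniteHypergraph.{u}) : Type (u + 1) where
  B : Type u
  [cstar : NonUnitalCStarAlgebra B]
  family : Family Γ B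

attribute [instance] Rep.cstar

theorem Family.norm_s_le {Γ : FiniteHypergraph.{u}} {B : Type v} [NonUnitalCStarAlgebra B]
    (F : Family Γ B) (e : Γ.E) : ‖F.s e‖ ≤ 1 := by
  have h : IsStarProjection (star (F.s e) * F.s e) := by
    refine ⟨?_, IsSelfAdjoint.star_mul_self _⟩
    rw [IsIdempotentElem, mul_assoc, ← mul_assoc (F.s e), F.partialIsometry_s]
  have h2 := h.norm_le
  rw [CStarRing.norm_star_mul_self] at h2
  nlinarith [norm_nonneg (F.s e)]

/-- The universal generator `p v`: its values in all the families of `Γ`. -/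
noncomputable def univP (Γ : FiniteHypergraph.{u}) (v : Γ.V) : lp (fun R : Rep Γ => R.B) ⊤ :=
  ⟨fun R => R.family.p v, memℓp_infty ⟨1, by
    rintro _ ⟨R, rfl⟩; exact (R.family.isStarProjection_p v).norm_le⟩⟩

/-- The universal generator `s e`: its values in all the families of `Γ`. -/
noncomputable def univS (Γ : FiniteHypergraph.{u}) (e : Γ.E) : lp (fun R : Rep Γ => R.B) ⊤ :=
  ⟨fun R => R.family.s e, memℓp_infty ⟨1, by
    rintro _ ⟨R, rfl⟩; exact R.family.norm_s_le e⟩⟩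

/-- `C*(Γ)` as a C*-subalgebra of the product of all C*-algebras that carry a family of `Γ`: the
one generated by the universal generators. Its norm is the largest one, the supremum
over all families; the universal property is `FiniteHypergraph.existsUnique_lift` below. -/
noncomputable def cstarSubalgebra (Γ : FiniteHypergraph.{u}) :
    NonUnitalStarSubalgebra ℂ (lp (fun R : Rep Γ => R.B) ⊤) :=
  (NonUnitalStarAlgebra.adjoin ℂ
    (Set.range Γ.univP ∪ Set.range Γ.univS)).topologicalClosure

instance (Γ : FiniteHypergraph.{u}) :
    IsClosed (Γ.cstarSubalgebra : Set (lp (fun R : Rep Γ => R.B) ⊤)) :=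
  NonUnitalStarSubalgebra.isClosed_topologicalClosure _

/-- The hypergraph C*-algebra `C*(Γ)`. -/
abbrev CStar (Γ : FiniteHypergraph.{u}) : Type (u + 1) := Γ.cstarSubalgebra

/-! ### The universal property of the hypergraph C*-algebra -/

theorem isStarProjection_finsum {ι : Type*} [Finite ι] {B : Type v} [NonUnitalCStarAlgebra B]
    (q : ι → B) (hq : ∀ i, IsStarProjection (q i)) (ho : ∀ i j, i ≠ j → q i * q j = 0)
    (S : Set ι) : IsStarProjection (∑ᶠ i ∈ S, q i) := by
  classical
  rw [finsum_mem_eq_finite_toFinset_sum _ (Set.toFinite S)]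
  induction (Set.toFinite S).toFinset using Finset.induction_on with
  | empty => simp
  | insert a s ha ih =>
    rw [Finset.sum_insert ha]
    refine (hq a).add ih ?_
    rw [Finset.mul_sum]
    exact Finset.sum_eq_zero fun j hj => ho a j (by rintro rfl; exact ha hj)

theorem cstarLE_iff_sub {B : Type v} [NonUnitalCStarAlgebra B] {p q : B}
    (hp : IsStarProjection p) (hq : IsStarProjection q) :
    CStarLE p q ↔ IsStarProjection (q - p) := by
  let _ := CStarAlgebra.spectralOrder B
  have := CStarAlgebra.spectralOrderedRing B
  rw [cstarLE_iff_le, hp.le_iff_sub hq]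

theorem isStarProjection_mul_star {B : Type v} [NonUnitalCStarAlgebra B] {s : B}
    (h : s * star s * s = s) : IsStarProjection (s * star s) :=
  ⟨by rw [IsIdempotentElem, ← mul_assoc, h], IsSelfAdjoint.mul_star_self _⟩

theorem Family.isStarProjection_sum_mul_star {Γ : FiniteHypergraph.{u}} {B : Type v}
    [NonUnitalCStarAlgebra B] (F : Family Γ B) (S : Set Γ.E) :
    IsStarProjection (∑ᶠ e ∈ S, F.s e * star (F.s e)) := by
  refine isStarProjection_finsum _ (fun e => isStarProjection_mul_star (F.partialIsometry_s e)) ?_ S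
  intro e f h
  rw [mul_assoc, ← mul_assoc (star (F.s e)), F.star_mul_of_ne e f h, zero_mul, mul_zero]

/-- A family whose relations can be tested in a jointly injective set of homomorphisms. -/
def Family.ofInjective {Γ : FiniteHypergraph.{u}} {B : Type v} [NonUnitalCStarAlgebra B]
    {ι : Type*} {C : ι → Type w} [∀ i, NonUnitalCStarAlgebra (C i)]
    (φ : ∀ i, B →⋆ₙₐ[ℂ] C i) (inj : ∀ x y, (∀ i, φ i x = φ i y) → x = y)
    (p : Γ.V → B) (s : Γ.E → B) (F : ∀ i, Family Γ (C i))
    (hp : ∀ i v, φ i (p v) = (F i).p v) (hs : ∀ i e, φ i (s e) = (F i).s e) : Family Γ B :=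
  have h1 : ∀ i (S : Set Γ.V), φ i (∑ᶠ v ∈ S, p v) = ∑ᶠ v ∈ S, (F i).p v := fun i S => by
    simp only [← hp]
    exact (φ i : B →+ C i).map_finsum_mem _ (Set.toFinite _)
  have h2 : ∀ i (S : Set Γ.E), φ i (∑ᶠ e ∈ S, s e * star (s e)) =
      ∑ᶠ e ∈ S, (F i).s e * star ((F i).s e) := fun i S => by
    simp only [← hs, ← map_star, ← map_mul]
    exact (φ i : B →+ C i).map_finsum_mem _ (Set.toFinite _)
  have hP : ∀ x : B, (∀ i, IsStarProjection (φ i x)) → IsStarProjection x := fun x h =>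
    ⟨inj _ _ fun i => by rw [map_mul]; exact (h i).1,
      inj _ _ fun i => by rw [map_star]; exact (h i).2⟩
  have hpP : ∀ v, IsStarProjection (p v) := fun v =>
    hP _ fun i => by rw [hp]; exact (F i).isStarProjection_p v
  have hS : ∀ S : Set Γ.V, IsStarProjection (∑ᶠ v ∈ S, p v) := fun S => hP _ fun i => by
    rw [h1]; exact isStarProjection_finsum _ (F i).isStarProjection_p (F i).orthogonal_p S
  have hT : ∀ S : Set Γ.E, IsStarProjection (∑ᶠ e ∈ S, s e * star (s e)) := fun S => hP _ fun i => by
    rw [h2]; exact (F i).isStarProjection_sum_mul_star S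
  have hpi : ∀ e, s e * star (s e) * s e = s e := fun e => inj _ _ fun i => by
    simp only [map_mul, map_star, hs, (F i).partialIsometry_s]
  { p := p
    s := s
    isStarProjection_p := hpP
    orthogonal_p := fun v w h => inj _ _ fun i => by
      simp only [map_mul, map_zero, hp, (F i).orthogonal_p v w h]
    partialIsometry_s := hpi
    star_mul_self_of_nonempty := fun e h => inj _ _ fun i => by
      rw [h1, map_mul, map_star, hs, (F i).star_mul_self_of_nonempty e h]
    star_mul_self_of_empty := fun e h => inj _ _ fun i => by
      rw [map_mul, map_star, hs, (F i).star_mul_self_of_empty e h]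
    star_mul_of_ne := fun e f h => inj _ _ fun i => by
      rw [map_mul, map_star, hs, hs, (F i).star_mul_of_ne e f h, map_zero]
    mul_star_le := fun e => by
      rw [cstarLE_iff_sub (isStarProjection_mul_star (hpi e)) (hS _)]
      refine hP _ fun i => ?_
      have := (F i).mul_star_le e
      rw [cstarLE_iff_sub (isStarProjection_mul_star ((F i).partialIsometry_s e))
        (isStarProjection_finsum _ (F i).isStarProjection_p (F i).orthogonal_p _)] at this
      rwa [map_sub, h1, map_mul, map_star, hs]
    le_sum_mul_star := fun v h => by
      rw [cstarLE_iff_sub (hpP v) (hT _)]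
      refine hP _ fun i => ?_
      have := (F i).le_sum_mul_star v h
      rw [cstarLE_iff_sub ((F i).isStarProjection_p v) ((F i).isStarProjection_sum_mul_star _)]
        at this
      rwa [map_sub, h2, hp] }

/-- The value of an element of `C*(Γ)` in a family. -/
noncomputable def evalRep {Γ : FiniteHypergraph.{u}} (R : Rep Γ) : Γ.CStar →⋆ₙₐ[ℂ] R.B where
  toFun x := x.1 R
  map_smul' _ _ := rfl
  map_zero' := rfl
  map_add' _ _ := rfl
  map_mul' _ _ := rfl
  map_star' _ := rfl

/-- The generators of `C*(Γ)`. -/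
noncomputable def universalFamily (Γ : FiniteHypergraph.{u}) : Family Γ Γ.CStar :=
  Family.ofInjective evalRep (fun _ _ h => Subtype.ext (lp.ext (funext h)))
    (fun v => ⟨Γ.univP v, NonUnitalStarSubalgebra.le_topologicalClosure _
      (NonUnitalStarAlgebra.subset_adjoin ℂ _ (Or.inl ⟨v, rfl⟩))⟩)
    (fun e => ⟨Γ.univS e, NonUnitalStarSubalgebra.le_topologicalClosure _
      (NonUnitalStarAlgebra.subset_adjoin ℂ _ (Or.inr ⟨e, rfl⟩))⟩)
    (fun R => R.family) (fun _ _ => rfl) (fun _ _ => rfl)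

theorem hom_ext {Γ : FiniteHypergraph.{u}} {B : Type v} [NonUnitalCStarAlgebra B]
    {φ ψ : Γ.CStar →⋆ₙₐ[ℂ] B}
    (hp : ∀ v, φ (Γ.universalFamily.p v) = ψ (Γ.universalFamily.p v))
    (hs : ∀ e, φ (Γ.universalFamily.s e) = ψ (Γ.universalFamily.s e)) : φ = ψ := by
  have hφ : Continuous φ := AddMonoidHomClass.continuous_of_bound φ 1 (by
    simpa only [one_mul] using NonUnitalStarAlgHom.norm_apply_le φ)
  have hψ : Continuous ψ := AddMonoidHomClass.continuous_of_bound ψ 1 (by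
    simpa only [one_mul] using NonUnitalStarAlgHom.norm_apply_le ψ)
  set S := NonUnitalStarAlgebra.adjoin ℂ (Set.range Γ.univP ∪ Set.range Γ.univS) with hS
  have key : ∀ x (hx : x ∈ S), φ ⟨x, NonUnitalStarSubalgebra.le_topologicalClosure _ hx⟩ =
      ψ ⟨x, NonUnitalStarSubalgebra.le_topologicalClosure _ hx⟩ := by
    intro x hx
    induction hx using NonUnitalStarAlgebra.adjoin_induction with
    | mem x hx =>
      obtain ⟨v, rfl⟩ | ⟨e, rfl⟩ := hx
      · exact hp v
      · exact hs e
    | add x y hx hy h1 h2 =>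
      exact (map_add φ ⟨x, NonUnitalStarSubalgebra.le_topologicalClosure _ hx⟩
        ⟨y, NonUnitalStarSubalgebra.le_topologicalClosure _ hy⟩).trans
        ((congrArg₂ (· + ·) h1 h2).trans (map_add ψ _ _).symm)
    | zero => exact (map_zero φ).trans (map_zero ψ).symm
    | mul x y hx hy h1 h2 =>
      exact (map_mul φ ⟨x, NonUnitalStarSubalgebra.le_topologicalClosure _ hx⟩
        ⟨y, NonUnitalStarSubalgebra.le_topologicalClosure _ hy⟩).trans
        ((congrArg₂ (· * ·) h1 h2).trans (map_mul ψ _ _).symm)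
    | smul r x hx h1 =>
      exact (map_smul φ r ⟨x, NonUnitalStarSubalgebra.le_topologicalClosure _ hx⟩).trans
        ((congrArg (r • ·) h1).trans (map_smul ψ r _).symm)
    | star x hx h1 =>
      exact (map_star φ ⟨x, NonUnitalStarSubalgebra.le_topologicalClosure _ hx⟩).trans
        ((congrArg star h1).trans (map_star ψ _).symm)
  ext ⟨x, hx⟩
  obtain ⟨a, ha, hlim⟩ := mem_closure_iff_seq_limit.1 hx
  have hlim' : Filter.Tendsto (fun n => (⟨a n, NonUnitalStarSubalgebra.le_topologicalClosure _
      (ha n)⟩ : Γ.CStar)) Filter.atTop (nhds ⟨x, hx⟩) := tendsto_subtype_rng.2 hlim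
  refine tendsto_nhds_unique ((hφ.tendsto _).comp hlim') ?_
  refine ((hψ.tendsto _).comp hlim').congr fun n => (key _ (ha n)).symm

/-- Formal *-polynomials in the generators. -/
inductive Word (Γ : FiniteHypergraph.{u}) : Type u
  | p (v : Γ.V)
  | s (e : Γ.E)
  | zero
  | add (x y : Word Γ)
  | mul (x y : Word Γ)
  | smul (z : ℂ) (x : Word Γ)
  | star (x : Word Γ)

/-- The value of a formal *-polynomial in a family. -/
noncomputable def Word.eval {Γ : FiniteHypergraph.{u}} {B : Type v} [NonUnitalCStarAlgebra B]
    (F : Family Γ B) : Word Γ → B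
  | .p v => F.p v
  | .s e => F.s e
  | .zero => 0
  | .add x y => x.eval F + y.eval F
  | .mul x y => x.eval F * y.eval F
  | .smul z x => z • x.eval F
  | .star x => Star.star (x.eval F)

theorem exists_small_model (D : Type v) [NonUnitalCStarAlgebra D] [Small.{u} D] :
    ∃ (D' : Type u) (_ : NonUnitalCStarAlgebra D') (j : D' →⋆ₙₐ[ℂ] D),
      Function.Injective j ∧ Function.Surjective j := by
  let ε : Shrink.{u} D ≃ D := (equivShrink D).symm
  let _ : NonUnitalRing (Shrink.{u} D) := ε.nonUnitalRing
  let _ : Module ℂ (Shrink.{u} D) := ε.module ℂ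
  let _ : StarRing (Shrink.{u} D) := ε.starRing
  have hadd : ∀ x y, ε (x + y) = ε x + ε y := fun _ _ => ε.apply_symm_apply _
  have hmul : ∀ x y, ε (x * y) = ε x * ε y := fun _ _ => ε.apply_symm_apply _
  have hzero : ε 0 = 0 := ε.apply_symm_apply _
  have hsmul : ∀ (z : ℂ) x, ε (z • x) = z • ε x := fun _ _ => ε.apply_symm_apply _
  have hstar : ∀ x, ε (star x) = star (ε x) := fun _ => ε.apply_symm_apply _
  let j : Shrink.{u} D →⋆ₙₐ[ℂ] D :=
    { toFun := ε
      map_smul' := hsmul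
      map_zero' := hzero
      map_add' := hadd
      map_mul' := hmul
      map_star' := hstar }
  let _ : NonUnitalNormedRing (Shrink.{u} D) :=
    NonUnitalNormedRing.induced (Shrink.{u} D) D j ε.injective
  have hiso : Isometry ε := fun _ _ => rfl
  have hnorm : ∀ x : Shrink.{u} D, ‖x‖ = ‖ε x‖ := fun _ => rfl
  have : CompleteSpace (Shrink.{u} D) :=
    (completeSpace_iff_isComplete_range hiso.isUniformInducing).2 (by
      rw [ε.surjective.range_eq]; exact isComplete_univ)
  have : CStarRing (Shrink.{u} D) := ⟨fun x => by
    rw [hnorm, hnorm, hmul, hstar]; exact CStarRing.norm_mul_self_le _⟩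
  have : IsScalarTower ℂ (Shrink.{u} D) (Shrink.{u} D) := ⟨fun z x y => ε.injective (by
    simp only [smul_eq_mul, hmul, hsmul, smul_mul_assoc])⟩
  have : SMulCommClass ℂ (Shrink.{u} D) (Shrink.{u} D) := ⟨fun z x y => ε.injective (by
    simp only [smul_eq_mul, hmul, hsmul, mul_smul_comm])⟩
  have : StarModule ℂ (Shrink.{u} D) := ⟨fun z x => ε.injective (by
    simp only [hsmul, hstar, star_smul])⟩
  have hns : ∀ (z : ℂ) (x : Shrink.{u} D), ‖z • x‖ ≤ ‖z‖ * ‖x‖ := fun z x => by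
    have h := norm_smul_le z (ε x)
    rw [← hsmul] at h
    exact h
  exact ⟨Shrink.{u} D, { norm_smul_le := hns }, j, ε.injective, ε.surjective⟩

/-- Every family, in whatever universe, lives in a C*-algebra of the universe of `Γ`. -/
theorem Family.exists_rep {Γ : FiniteHypergraph.{u}} {B : Type v} [NonUnitalCStarAlgebra B]
    (F : Family Γ B) : ∃ (R : Rep Γ) (j : R.B →⋆ₙₐ[ℂ] B),
      (∀ v, j (R.family.p v) = F.p v) ∧ ∀ e, j (R.family.s e) = F.s e := by
  let D₀ : NonUnitalStarSubalgebra ℂ B :=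
    { carrier := Set.range (Word.eval F)
      add_mem' := by rintro _ _ ⟨x, rfl⟩ ⟨y, rfl⟩; exact ⟨.add x y, rfl⟩
      zero_mem' := ⟨.zero, rfl⟩
      mul_mem' := by rintro _ _ ⟨x, rfl⟩ ⟨y, rfl⟩; exact ⟨.mul x y, rfl⟩
      smul_mem' := by rintro z _ ⟨x, rfl⟩; exact ⟨.smul z x, rfl⟩
      star_mem' := by rintro _ ⟨x, rfl⟩; exact ⟨.star x, rfl⟩ }
  let D := D₀.topologicalClosure
  have : IsClosed (D : Set B) := NonUnitalStarSubalgebra.isClosed_topologicalClosure _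
  have : Small.{u} D := by
    have : ∀ x : D, ∃ a : ℕ → Word Γ,
        Filter.Tendsto (fun n => (a n).eval F) Filter.atTop (nhds (x : B)) := by
      rintro ⟨x, hx⟩
      obtain ⟨a, ha, hlim⟩ := mem_closure_iff_seq_limit.1 hx
      choose b hb using ha
      exact ⟨b, by simpa only [hb] using hlim⟩
    choose a ha using this
    refine small_of_injective (f := a) fun x y h => Subtype.ext ?_
    exact tendsto_nhds_unique (ha x) (h ▸ ha y)
  obtain ⟨D', _, j, hj, hj'⟩ := exists_small_model.{u} D
  have mem : ∀ x : Word Γ, x.eval F ∈ D := fun x =>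
    NonUnitalStarSubalgebra.le_topologicalClosure _ ⟨x, rfl⟩
  choose p hp using fun v => hj' ⟨F.p v, mem (.p v)⟩
  choose s hs using fun e => hj' ⟨F.s e, mem (.s e)⟩
  let k : D' →⋆ₙₐ[ℂ] B := (NonUnitalStarSubalgebraClass.subtype D).comp j
  have hk : Function.Injective k := Subtype.val_injective.comp hj
  have kp : ∀ v, k (p v) = F.p v := fun v => congrArg Subtype.val (hp v)
  have ks : ∀ e, k (s e) = F.s e := fun e => congrArg Subtype.val (hs e)
  exact ⟨⟨D', Family.ofInjective (fun _ : Unit => k) (fun _ _ h => hk (h ())) p s (fun _ => F)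
    (fun _ => kp) (fun _ => ks)⟩, k, kp, ks⟩

/-- `C*(Γ)` is universal: a family of `Γ` in any C*-algebra is the image of the generators
under exactly one *-homomorphism. -/
theorem existsUnique_lift {Γ : FiniteHypergraph.{u}} {B : Type v} [NonUnitalCStarAlgebra B]
    (F : Family Γ B) : ∃! φ : Γ.CStar →⋆ₙₐ[ℂ] B,
      (∀ v, φ (Γ.universalFamily.p v) = F.p v) ∧ ∀ e, φ (Γ.universalFamily.s e) = F.s e := by
  obtain ⟨R, j, hp, hs⟩ := F.exists_rep
  refine ⟨j.comp (evalRep R), ⟨hp, hs⟩, fun ψ hψ => hom_ext (fun v => ?_) fun e => ?_⟩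
  · rw [hψ.1, ← hp]; rfl
  · rw [hψ.2, ← hs]; rfl

/-! ### Hypergraph minors -/

/-- `Δ` is, up to renaming vertices and edges, the hypergraph with vertex set `W`, edge set `F`,
range map `r` and source map `s` (the last two restricted to `F`). -/
def IsCopy (Δ : FiniteHypergraph.{u}) {V E : Type u} (W : Set V) (F : Set E)
    (r s : E → Set V) : Prop :=
  ∃ (φ : Δ.V ≃ W) (ψ : Δ.E ≃ F), ∀ e : Δ.E,
    (fun v => (φ v : V)) '' Δ.range e = r (ψ e) ∧ (fun v => (φ v : V)) '' Δ.source e = s (ψ e)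

/-- `Δ` is obtained from `Γ` by deleting a vertex. -/
def VertexDeletion (Γ Δ : FiniteHypergraph.{u}) : Prop :=
  ∃ v : Γ.V, Δ.IsCopy {v}ᶜ {e | Γ.source e ≠ {v}}
    (fun e => Γ.range e \ {v}) (fun e => Γ.source e \ {v})

/-- `Δ` is obtained from `Γ` by deleting the edge `f`. -/
def EdgeDeletionAt (Γ Δ : FiniteHypergraph.{u}) (f : Γ.E) : Prop :=
  Δ.IsCopy Set.univ {f}ᶜ Γ.range Γ.source

/-- `Δ` is obtained from `Γ` by deleting an edge. -/
def EdgeDeletion (Γ Δ : FiniteHypergraph.{u}) : Prop :=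
  ∃ f : Γ.E, Γ.EdgeDeletionAt Δ f

/-- `Δ` is obtained from `Γ` by deleting an edge with empty range whose source meets the source of
no other edge. -/
def TrivialEdgeDeletion (Γ Δ : FiniteHypergraph.{u}) : Prop :=
  ∃ f : Γ.E, Γ.range f = ∅ ∧ (∀ e, e ≠ f → Γ.source e ∩ Γ.source f = ∅) ∧ Γ.EdgeDeletionAt Δ f

open Classical in
/-- `Δ` is obtained from `Γ` by contracting an edge forward. -/
def ForwardContraction (Γ Δ : FiniteHypergraph.{u}) : Prop :=
  ∃ (f : Γ.E) (w : Γ.V), Γ.source f = {w} ∧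
    (∀ e, (Γ.source e ∩ Γ.source f).Nonempty → e = f) ∧
    (¬ ∃ e, w ∈ Γ.range e ∧ (Γ.range e ∩ Γ.range f).Nonempty) ∧
    Δ.IsCopy {w}ᶜ {f}ᶜ
      (fun e => if w ∈ Γ.range e then (Γ.range e \ {w}) ∪ Γ.range f else Γ.range e)
      Γ.source

open Classical in
/-- `Δ` is obtained from `Γ` by contracting an edge backward. -/
def BackwardContraction (Γ Δ : FiniteHypergraph.{u}) : Prop :=
  ∃ (f : Γ.E) (w : Γ.V), Γ.range f = {w} ∧
    (∀ e, (Γ.source e ∩ Γ.source f).Nonempty → e = f) ∧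
    (¬ ∃ e, (Γ.range e ∩ Γ.source f).Nonempty ∧ w ∈ Γ.range e) ∧
    Δ.IsCopy {w}ᶜ {f}ᶜ
      (fun e => if w ∈ Γ.range e then (Γ.range e \ {w}) ∪ Γ.source f else Γ.range e)
      (fun e => if w ∈ Γ.source e then (Γ.source e \ {w}) ∪ Γ.source f else Γ.source e)

open Classical in
/-- `Δ` is obtained from `Γ` by cutting an edge. -/
def EdgeCutting (Γ Δ : FiniteHypergraph.{u}) : Prop :=
  ∃ f : Γ.E, Δ.IsCopy Set.univ Set.univ
    (fun e => if e = f then ∅ else Γ.range e) Γ.source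

open Classical in
/-- `Δ` is obtained from `Γ` by source separation. The new vertex is `none : Option Γ.V`. -/
def SourceSeparation (Γ Δ : FiniteHypergraph.{u}) : Prop :=
  ∃ (F : Set Γ.E) (w : Γ.V), F.Nonempty ∧ F ⊂ {e | w ∈ Γ.source e} ∧
    Δ.IsCopy (Set.univ : Set (Option Γ.V)) (Set.univ : Set Γ.E)
      (fun e => if w ∈ Γ.range e then some '' Γ.range e ∪ {none} else some '' Γ.range e)
      (fun e => if e ∈ F then some '' (Γ.source e \ {w}) ∪ {none} else some '' Γ.source e)

/-- `Δ` is obtained from `Γ` by decomposing the range of an edge `f`. The old edges are the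
`Sum.inl e` with `e ≠ f`, the new ones are the `Sum.inr (f, v)` with `v` in the range of `f`. -/
def RangeDecomposition (Γ Δ : FiniteHypergraph.{u}) : Prop :=
  ∃ f : Γ.E, (Γ.range f).Nonempty ∧
    Δ.IsCopy (Set.univ : Set Γ.V)
      (Sum.inl '' {f}ᶜ ∪ (fun v => Sum.inr (f, v)) '' Γ.range f : Set (Γ.E ⊕ Γ.E × Γ.V))
      (Sum.elim Γ.range (fun x => {x.2})) (Sum.elim Γ.source (fun x => Γ.source x.1))

/-- `Δ` is obtained from `Γ` by one of the seven minor operations. -/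
def MinorStep (Γ Δ : FiniteHypergraph.{u}) : Prop :=
  Γ.VertexDeletion Δ ∨ Γ.EdgeDeletion Δ ∨ Γ.ForwardContraction Δ ∨ Γ.BackwardContraction Δ ∨
    Γ.EdgeCutting Δ ∨ Γ.SourceSeparation Δ ∨ Γ.RangeDecomposition Δ

/-- `Δ ≤ Γ`: the hypergraph `Δ` is a minor of `Γ`. -/
def IsMinor (Δ Γ : FiniteHypergraph.{u}) : Prop := Relation.ReflTransGen MinorStep Γ Δ

/-- `Δ` is obtained from `Γ` by one source separation, backward contraction, range decomposition or
trivial edge deletion. -/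
def NormalizationStep (Γ Δ : FiniteHypergraph.{u}) : Prop :=
  Γ.SourceSeparation Δ ∨ Γ.BackwardContraction Δ ∨ Γ.RangeDecomposition Δ ∨
    Γ.TrivialEdgeDeletion Δ

/-- Normal hypergraphs. -/
structure IsNormal (Γ : FiniteHypergraph.{u}) : Prop where
  range_le_one : ∀ e, (Γ.range e).encard ≤ 1
  meets_or_loop : ∀ e, (∃ f, f ≠ e ∧ (Γ.source e ∩ Γ.source f).Nonempty) ∨
    ((Γ.range e).Nonempty ∧ Γ.range e ⊆ Γ.source e)
  inter_eq_one : ∀ e f, e ≠ f → (Γ.source e ∩ Γ.source f).encard = 1 →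
    ((Γ.source e).encard = 1 ∧ (Γ.source f).encard = 1) ∨
      ∃ g, g ≠ e ∧ Γ.source e ∩ Γ.source f ⊂ Γ.source e ∩ Γ.source g

end FiniteHypergraph

/-! ### Morita equivalence of C*-algebras -/

/-- An imprimitivity bimodule: a Banach space `X` that is an `A`-`B`-bimodule, a full left Hilbert
`A`-module and a full right Hilbert `B`-module, such that each algebra acts by adjointable operators
for the other inner product and `⟨x, y⟩_A z = x ⟨y, z⟩_B`. -/
structure ImprimitivityBimodule (A B X : Type*) [NonUnitalCStarAlgebra A]
    [NonUnitalCStarAlgebra B] [NormedAddCommGroup X] [NormedSpace ℂ X] [CompleteSpace X] where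
  /-- the left action, `lsmul a x = a x` -/
  lsmul : A →ₗ[ℂ] X →ₗ[ℂ] X
  /-- the right action, `rsmul b x = x b` -/
  rsmul : B →ₗ[ℂ] X →ₗ[ℂ] X
  /-- the `A`-valued inner product, linear in the first variable -/
  innerL : X →ₗ[ℂ] X →ₗ⋆[ℂ] A
  /-- the `B`-valued inner product, linear in the second variable -/
  innerR : X →ₗ⋆[ℂ] X →ₗ[ℂ] B
  lsmul_mul : ∀ a a' x, lsmul (a * a') x = lsmul a (lsmul a' x)
  rsmul_mul : ∀ b b' x, rsmul (b * b') x = rsmul b' (rsmul b x)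
  lsmul_rsmul : ∀ a b x, lsmul a (rsmul b x) = rsmul b (lsmul a x)
  innerL_lsmul : ∀ a x y, innerL (lsmul a x) y = a * innerL x y
  innerR_rsmul : ∀ b x y, innerR x (rsmul b y) = innerR x y * b
  star_innerL : ∀ x y, star (innerL x y) = innerL y x
  star_innerR : ∀ x y, star (innerR x y) = innerR y x
  innerL_self_nonneg : ∀ x, CStarLE 0 (innerL x x)
  innerR_self_nonneg : ∀ x, CStarLE 0 (innerR x x)
  norm_sq_eq_innerL : ∀ x, ‖x‖ ^ 2 = ‖innerL x x‖
  norm_sq_eq_innerR : ∀ x, ‖x‖ ^ 2 = ‖innerR x x‖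
  dense_innerL : Dense (Submodule.span ℂ {a : A | ∃ x y, innerL x y = a} : Set A)
  dense_innerR : Dense (Submodule.span ℂ {b : B | ∃ x y, innerR x y = b} : Set B)
  innerL_rsmul : ∀ b x y, innerL (rsmul b x) y = innerL x (rsmul (star b) y)
  innerR_lsmul : ∀ a x y, innerR (lsmul a x) y = innerR x (lsmul (star a) y)
  innerL_lsmul_eq : ∀ x y z, lsmul (innerL x y) z = rsmul (innerR y z) x

/-- (Strong) Morita equivalence of C*-algebras: there is an imprimitivity bimodule. -/
def IsCStarMoritaEquivalent (A B : Type v) [NonUnitalCStarAlgebra A]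
    [NonUnitalCStarAlgebra B] : Prop :=
  ∃ (X : Type v) (_ : NormedAddCommGroup X) (_ : NormedSpace ℂ X) (_ : CompleteSpace X),
    Nonempty (ImprimitivityBimodule A B X)

/-! Each way of failing to be normal is attacked by one operation. An edge with several range
vertices is decomposed. An edge `f` whose source meets no other source, and whose range is empty or
leaves the source, is deleted if the range is empty and contracted backward otherwise. If the third
condition fails for `e` and `f` with common vertex `w`, then every source through `w` other than
that of `e` meets it in `w` alone, and the edges with the source of `e` are separated at `w`. The
process terminates because a lexicographic rank drops (`exists_normalizationStep`): separation
destroys a pair of distinct meeting sources; contraction creates no such pair and loses a vertex;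
decomposition and deletion keep the vertices, create no pair and lower the total range defect.

On the side of the algebras, each step makes the new C*-algebra a full corner of the old one. This
relation is transitive (`IsFullCorner.trans`), and a full corner `P B P` is Morita equivalent to `B`
through the bimodule `P B` (`IsFullCorner.isCStarMoritaEquivalent`). For deletion, decomposition and
separation the corner is everything: each algebra contains a family for the other hypergraph, and
the two induced homomorphisms are inverse on generators. In the case of separation this works
because the range projection of the separated edges commutes with `p w` (`Family.commute_qSum_p`),
which splits `p w` into two vertices.

Backward contraction of `f` with range `{w}` is the substantial case. There `s f` is a partial
isometry from `p w` onto the projection of the source of `f`, so the sum `P` of the other vertex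
projections is full. The contraction maps into the corner of `P`. The map is injective
(`contract_lift_injective`) because a family of the contraction can be expanded, inside 2 by 2
matrices, to a family of the original hypergraph; it is onto the corner because the elements whose
entries lie in its range form a closed *-subalgebra containing the generators
(`contractionEntries_eq_top`). -/

theorem IsStarProjection.mul_star_mul_cancel {B : Type v} [NonUnitalCStarAlgebra B] {s : B}
    (h : IsStarProjection (star s * s)) : s * star s * s = s := by
  have h1 : star s * s * (star s * s) = star s * s := h.1
  have h2 : star (s * star s * s - s) * (s * star s * s - s) = 0 := by
    simp only [star_sub, star_mul, star_star, sub_mul, mul_sub, mul_assoc] at h1 ⊢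
    simp only [h1, sub_self]
  exact sub_eq_zero.1 (CStarRing.star_mul_self_eq_zero_iff _ |>.1 h2)

theorem CStarLE.of_mul_eq {B : Type v} [NonUnitalCStarAlgebra B] {p q : B}
    (hp : IsStarProjection p) (hq : IsStarProjection q) (h : q * p = p) : CStarLE p q :=
  (FiniteHypergraph.cstarLE_iff_sub hp hq).2 (hp.sub_of_mul_eq_right hq h)

theorem CStarLE.mul_eq {B : Type v} [NonUnitalCStarAlgebra B] {p q : B}
    (hp : IsStarProjection p) (hq : IsStarProjection q) (h : CStarLE p q) : q * p = p := by
  -- Idempotency of `q - p` only gives `q * p + p * q = 2 p`, so the conclusion needs division by 2.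
  have : IsAddTorsionFree B := by
    have := Module.compHom B (algebraMap ℚ ℂ)
    exact .of_module_rat B
  exact (hp.sub_iff_mul_eq_right hq).1 ((FiniteHypergraph.cstarLE_iff_sub hp hq).1 h)

theorem finsum_mem_mul_eq_self {ι R : Type*} [Finite ι] [NonUnitalSemiring R] {a : ι → R} {x : R}
    {T : Set ι} {i : ι} (hi : i ∈ T) (h : a i * x = x) (h' : ∀ j, j ≠ i → a j * x = 0) :
    (∑ᶠ j ∈ T, a j) * x = x := by
  have h1 := finsum_mem_insert a (s := T \ {i}) (fun hi => hi.2 rfl) (Set.toFinite _)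
  rw [Set.insert_sdiff_singleton, Set.insert_eq_of_mem hi] at h1
  rw [h1, add_mul, h, finsum_mem_mul' _ _ (Set.toFinite _)]
  rw [finsum_mem_eq_zero_of_forall_eq_zero fun j hj => h' j hj.2, add_zero]

/-! ### Calculus of projections and partial isometries in a family -/

namespace FiniteHypergraph

namespace Family

variable {Γ : FiniteHypergraph.{u}} {B : Type v} [NonUnitalCStarAlgebra B] (F : Family Γ B)

/-- The sum of the vertex projections over a set of vertices. -/
noncomputable def pSum (S : Set Γ.V) : B := ∑ᶠ v ∈ S, F.p v

/-- The sum of the range projections over a set of edges. -/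
noncomputable def qSum (T : Set Γ.E) : B := ∑ᶠ e ∈ T, F.s e * star (F.s e)

theorem isStarProjection_pSum (S : Set Γ.V) : IsStarProjection (F.pSum S) :=
  isStarProjection_finsum _ F.isStarProjection_p F.orthogonal_p S

theorem isStarProjection_qSum (T : Set Γ.E) : IsStarProjection (F.qSum T) :=
  F.isStarProjection_sum_mul_star T

@[simp] theorem star_p (v : Γ.V) : star (F.p v) = F.p v := (F.isStarProjection_p v).2
@[simp] theorem star_pSum (S : Set Γ.V) : star (F.pSum S) = F.pSum S := (F.isStarProjection_pSum S).2
@[simp] theorem star_qSum (T : Set Γ.E) : star (F.qSum T) = F.qSum T := (F.isStarProjection_qSum T).2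
@[simp] theorem p_mul_p (v : Γ.V) : F.p v * F.p v = F.p v := (F.isStarProjection_p v).1
@[simp] theorem pSum_mul_self (S : Set Γ.V) : F.pSum S * F.pSum S = F.pSum S :=
  (F.isStarProjection_pSum S).1

@[simp] theorem pSum_empty : F.pSum ∅ = 0 := finsum_mem_empty
@[simp] theorem pSum_singleton (v : Γ.V) : F.pSum {v} = F.p v := finsum_mem_singleton

theorem pSum_eq_sum (S : Set Γ.V) [Fintype S] : F.pSum S = ∑ v : S, F.p v := by
  rw [← finsum_eq_sum_of_fintype]
  exact (finsum_set_coe_eq_finsum_mem (f := F.p) S).symm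

theorem pSum_union {S T : Set Γ.V} (h : Disjoint S T) : F.pSum (S ∪ T) = F.pSum S + F.pSum T :=
  finsum_mem_union h (Set.toFinite _) (Set.toFinite _)

theorem pSum_sdiff_add {S : Set Γ.V} {v : Γ.V} (h : v ∈ S) :
    F.pSum (S \ {v}) + F.p v = F.pSum S := by
  rw [← F.pSum_singleton v, ← F.pSum_union Set.disjoint_sdiff_left,
    Set.sdiff_union_of_subset (Set.singleton_subset_iff.2 h)]

theorem qSum_union {S T : Set Γ.E} (h : Disjoint S T) : F.qSum (S ∪ T) = F.qSum S + F.qSum T :=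
  finsum_mem_union h (Set.toFinite _) (Set.toFinite _)

theorem mul_pSum_congr {S : Set Γ.V} {a b : B} (h : ∀ v ∈ S, a * F.p v = b * F.p v) :
    a * F.pSum S = b * F.pSum S := by
  rw [pSum, mul_finsum_mem' _ _ (Set.toFinite S), mul_finsum_mem' _ _ (Set.toFinite S)]
  exact finsum_mem_congr rfl h

theorem mul_pSum_eq_zero {S : Set Γ.V} {a : B} (h : ∀ v ∈ S, a * F.p v = 0) :
    a * F.pSum S = 0 := by
  rw [F.mul_pSum_congr (b := 0) (by simpa using h), zero_mul]

theorem pSum_mul_eq_zero {S : Set Γ.V} {a : B} (h : ∀ v ∈ S, F.p v * a = 0) :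
    F.pSum S * a = 0 := by
  rw [pSum, finsum_mem_mul' _ _ (Set.toFinite S)]
  exact finsum_mem_eq_zero_of_forall_eq_zero h

theorem mul_qSum_eq_self {T : Set Γ.E} {a : B} (h : ∀ e ∈ T, a * F.s e = F.s e) :
    a * F.qSum T = F.qSum T := by
  rw [qSum, mul_finsum_mem' _ _ (Set.toFinite T)]
  exact finsum_mem_congr rfl fun e he => by rw [← mul_assoc, h e he]

theorem mul_qSum_congr {T : Set Γ.E} {a b : B} (h : ∀ e ∈ T, a * F.s e = b * F.s e) :
    a * F.qSum T = b * F.qSum T := by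
  rw [qSum, mul_finsum_mem' _ _ (Set.toFinite T), mul_finsum_mem' _ _ (Set.toFinite T)]
  exact finsum_mem_congr rfl fun e he => by rw [← mul_assoc, h e he, mul_assoc]

theorem mul_qSum_eq_zero {T : Set Γ.E} {a : B} (h : ∀ e ∈ T, a * F.s e = 0) :
    a * F.qSum T = 0 := by
  rw [qSum, mul_finsum_mem' _ _ (Set.toFinite T)]
  exact finsum_mem_eq_zero_of_forall_eq_zero fun e he => by rw [← mul_assoc, h e he, zero_mul]

theorem p_mul_pSum_of_notMem {S : Set Γ.V} {v : Γ.V} (h : v ∉ S) : F.p v * F.pSum S = 0 :=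
  F.mul_pSum_eq_zero fun w hw => F.orthogonal_p v w (by rintro rfl; exact h hw)

theorem pSum_mul_p_of_notMem {S : Set Γ.V} {v : Γ.V} (h : v ∉ S) : F.pSum S * F.p v = 0 :=
  F.pSum_mul_eq_zero fun w hw => F.orthogonal_p w v (by rintro rfl; exact h hw)

theorem pSum_mul_p_of_mem {S : Set Γ.V} {v : Γ.V} (h : v ∈ S) : F.pSum S * F.p v = F.p v := by
  rw [← F.pSum_sdiff_add h, add_mul, F.pSum_mul_p_of_notMem (by simp), zero_add, F.p_mul_p]

theorem p_mul_pSum_of_mem {S : Set Γ.V} {v : Γ.V} (h : v ∈ S) : F.p v * F.pSum S = F.p v := by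
  simpa using congrArg star (F.pSum_mul_p_of_mem h)

theorem mul_pSum_eq_self {S : Set Γ.V} {x : B} (h : ∀ v ∈ S, x * F.p v = F.p v) :
    x * F.pSum S = F.pSum S := by
  rw [F.mul_pSum_congr (b := F.pSum S), F.pSum_mul_self]
  exact fun v hv => by rw [h v hv, F.pSum_mul_p_of_mem hv]

theorem pSum_mul_pSum_of_disjoint {S T : Set Γ.V} (h : Disjoint S T) : F.pSum S * F.pSum T = 0 :=
  F.mul_pSum_eq_zero fun _ hv => F.pSum_mul_p_of_notMem (h.notMem_of_mem_right hv)

theorem pSum_mul_pSum_of_subset {S T : Set Γ.V} (h : T ⊆ S) : F.pSum S * F.pSum T = F.pSum T := by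
  rw [F.mul_pSum_congr (b := F.pSum T), F.pSum_mul_self]
  intro v hv
  rw [F.pSum_mul_p_of_mem (h hv), F.pSum_mul_p_of_mem hv]

theorem pSum_mul_pSum_of_subset' {S T : Set Γ.V} (h : T ⊆ S) : F.pSum T * F.pSum S = F.pSum T := by
  simpa using congrArg star (F.pSum_mul_pSum_of_subset h)

theorem star_s_of_range_eq_empty {e : Γ.E} (h : Γ.range e = ∅) : star (F.s e) = F.s e := by
  have := congrArg star (F.star_mul_self_of_empty e h)
  rw [star_mul, star_star, F.star_mul_self_of_empty e h] at this
  exact this.symm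

theorem s_mul_s_of_range_eq_empty {e : Γ.E} (h : Γ.range e = ∅) : F.s e * F.s e = F.s e := by
  simpa only [F.star_s_of_range_eq_empty h] using F.star_mul_self_of_empty e h

theorem star_s_mul_s {e : Γ.E} (h : (Γ.range e).Nonempty) :
    star (F.s e) * F.s e = F.pSum (Γ.range e) := F.star_mul_self_of_nonempty e h

theorem s_mul_pSum_range {e : Γ.E} (h : (Γ.range e).Nonempty) :
    F.s e * F.pSum (Γ.range e) = F.s e := by
  rw [← F.star_s_mul_s h, ← mul_assoc, F.partialIsometry_s]

theorem pSum_source_mul_s (e : Γ.E) : F.pSum (Γ.source e) * F.s e = F.s e := by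
  have h := CStarLE.mul_eq (isStarProjection_mul_star (F.partialIsometry_s e))
    (F.isStarProjection_pSum _) (F.mul_star_le e)
  rw [← F.partialIsometry_s e, ← mul_assoc, h]

theorem pSum_mul_s_of_subset {S : Set Γ.V} {e : Γ.E} (h : Γ.source e ⊆ S) :
    F.pSum S * F.s e = F.s e := by
  rw [← F.pSum_source_mul_s e, ← mul_assoc, F.pSum_mul_pSum_of_subset h]

theorem pSum_mul_s_of_disjoint {S : Set Γ.V} {e : Γ.E} (h : Disjoint S (Γ.source e)) :
    F.pSum S * F.s e = 0 := by
  rw [← F.pSum_source_mul_s e, ← mul_assoc, F.pSum_mul_pSum_of_disjoint h, zero_mul]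

theorem p_mul_s_of_notMem {v : Γ.V} {e : Γ.E} (h : v ∉ Γ.source e) : F.p v * F.s e = 0 := by
  rw [← F.pSum_singleton v, F.pSum_mul_s_of_disjoint (Set.disjoint_singleton_left.2 h)]

/-- An edge with empty range is a projection below its source, so for such an edge the source takes
the role of the range on the right. -/
theorem s_mul_pSum_of_disjoint {S : Set Γ.V} {e : Γ.E} (h : Disjoint (Γ.range e) S)
    (h' : Γ.range e = ∅ → Disjoint (Γ.source e) S) : F.s e * F.pSum S = 0 := by
  rcases (Γ.range e).eq_empty_or_nonempty with h0 | h0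
  · simpa [F.star_s_of_range_eq_empty h0] using
      congrArg star (F.pSum_mul_s_of_disjoint (h' h0).symm)
  · rw [← F.s_mul_pSum_range h0, mul_assoc, F.pSum_mul_pSum_of_disjoint h, mul_zero]

theorem s_mul_pSum_of_subset {S : Set Γ.V} {e : Γ.E} (h : Γ.range e ⊆ S)
    (h' : Γ.range e = ∅ → Γ.source e ⊆ S) : F.s e * F.pSum S = F.s e := by
  rcases (Γ.range e).eq_empty_or_nonempty with h0 | h0
  · simpa [F.star_s_of_range_eq_empty h0] using congrArg star (F.pSum_mul_s_of_subset (h' h0))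
  · rw [← F.s_mul_pSum_range h0, mul_assoc, F.pSum_mul_pSum_of_subset' h]

theorem pSum_univ_mul_s (e : Γ.E) : F.pSum Set.univ * F.s e = F.s e :=
  F.pSum_mul_s_of_subset (Set.subset_univ _)

theorem s_mul_pSum_univ (e : Γ.E) : F.s e * F.pSum Set.univ = F.s e :=
  F.s_mul_pSum_of_subset (Set.subset_univ _) fun _ => Set.subset_univ _

theorem qSum_mul_s_of_notMem {T : Set Γ.E} {e : Γ.E} (h : e ∉ T) : F.qSum T * F.s e = 0 := by
  rw [qSum, finsum_mem_mul' _ _ (Set.toFinite T)]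
  refine finsum_mem_eq_zero_of_forall_eq_zero fun f hf => ?_
  rw [mul_assoc, F.star_mul_of_ne f e (by rintro rfl; exact h hf), mul_zero]

theorem qSum_mul_s_of_mem {T : Set Γ.E} {e : Γ.E} (h : e ∈ T) : F.qSum T * F.s e = F.s e := by
  have h1 : F.qSum T = F.qSum (T \ {e}) + F.s e * star (F.s e) := by
    have : F.qSum {e} = F.s e * star (F.s e) := finsum_mem_singleton
    rw [← this, ← F.qSum_union Set.disjoint_sdiff_left,
      Set.sdiff_union_of_subset (Set.singleton_subset_iff.2 h)]
  rw [h1, add_mul, F.qSum_mul_s_of_notMem (by simp), zero_add, F.partialIsometry_s]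

theorem qSum_mul_qSum_of_disjoint {S T : Set Γ.E} (h : Disjoint S T) :
    F.qSum S * F.qSum T = 0 :=
  F.mul_qSum_eq_zero fun _ he => F.qSum_mul_s_of_notMem (h.notMem_of_mem_right he)

theorem qSum_mul_p {v : Γ.V} {e : Γ.E} (h : v ∈ Γ.source e) :
    F.qSum {e | v ∈ Γ.source e} * F.p v = F.p v :=
  CStarLE.mul_eq (F.isStarProjection_p v) (F.isStarProjection_qSum _) (F.le_sum_mul_star v ⟨e, h⟩)

/-- A family from relations in product form. The inequalities say that whatever acts as a left
identity on the larger side acts as a left identity on the smaller side. -/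
def ofMul (p : Γ.V → B) (s : Γ.E → B) (hp : ∀ v, IsStarProjection (p v))
    (ho : ∀ v w, v ≠ w → p v * p w = 0)
    (hne : ∀ e, (Γ.range e).Nonempty → star (s e) * s e = ∑ᶠ v ∈ Γ.range e, p v)
    (hemp : ∀ e, Γ.range e = ∅ → star (s e) * s e = s e)
    (hst : ∀ e f, e ≠ f → star (s e) * s f = 0)
    (hsrc : ∀ e x, (∀ v ∈ Γ.source e, x * p v = p v) → x * s e = s e)
    (hle : ∀ v x, (∃ e, v ∈ Γ.source e) → (∀ e, v ∈ Γ.source e → x * s e = s e) →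
      x * p v = p v) : Family Γ B :=
  have hpi : ∀ e, s e * star (s e) * s e = s e := fun e => by
    refine IsStarProjection.mul_star_mul_cancel ?_
    rcases (Γ.range e).eq_empty_or_nonempty with h0 | h0
    · have h1 := hemp e h0
      refine ⟨?_, IsSelfAdjoint.star_mul_self _⟩
      have h2 := congrArg star h1
      rw [star_mul, star_star, h1] at h2
      rw [← h2] at h1
      rw [← h2, h1]
      exact h1
    · rw [hne e h0]
      exact isStarProjection_finsum _ hp ho _
  { p := p
    s := s
    isStarProjection_p := hp
    orthogonal_p := ho
    partialIsometry_s := hpi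
    star_mul_self_of_nonempty := hne
    star_mul_self_of_empty := hemp
    star_mul_of_ne := hst
    -- The test element is the larger projection itself: a sum of orthogonal projections is a left
    -- identity for each summand.
    mul_star_le := fun e => CStarLE.of_mul_eq (isStarProjection_mul_star (hpi e))
      (isStarProjection_finsum _ hp ho _) (by
        rw [← mul_assoc, hsrc e _ fun v hv => finsum_mem_mul_eq_self hv (hp v).1 fun w h => ho w v h])
    le_sum_mul_star := fun v ⟨e, he⟩ => CStarLE.of_mul_eq (hp v)
      (isStarProjection_finsum _ (fun e => isStarProjection_mul_star (hpi e)) (fun e f h => by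
        rw [mul_assoc, ← mul_assoc (star (s e)), hst e f h, zero_mul, mul_zero]) _) (hle v _ ⟨e, he⟩ fun e he =>
          finsum_mem_mul_eq_self he (hpi e) fun f hf => by rw [mul_assoc, hst f e hf, mul_zero]) }

theorem mul_s_eq_self {e : Γ.E} {x : B} (h : ∀ v ∈ Γ.source e, x * F.p v = F.p v) :
    x * F.s e = F.s e := by
  rw [← F.pSum_source_mul_s e, ← mul_assoc, F.mul_pSum_eq_self h]

/-- A vertex that emits edges lies below the sum of their range projections, so left multiplication
on `p v` is determined on these edges. -/
theorem mul_p_congr {v : Γ.V} {x y : B} (h : ∃ e, v ∈ Γ.source e)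
    (h' : ∀ e, v ∈ Γ.source e → x * F.s e = y * F.s e) : x * F.p v = y * F.p v := by
  obtain ⟨e, he⟩ := h
  rw [← F.qSum_mul_p he, ← mul_assoc, ← mul_assoc, F.mul_qSum_congr (T := {e | v ∈ Γ.source e}) h']

theorem mul_p_eq_self {v : Γ.V} {x : B} (h : ∃ e, v ∈ Γ.source e)
    (h' : ∀ e, v ∈ Γ.source e → x * F.s e = F.s e) : x * F.p v = F.p v := by
  obtain ⟨e, he⟩ := h
  rw [← F.qSum_mul_p he, ← mul_assoc, F.mul_qSum_eq_self (T := {e | v ∈ Γ.source e}) h']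

/-- The homomorphism from `C*(Γ)` given by a family. -/
noncomputable def lift : Γ.CStar →⋆ₙₐ[ℂ] B := (existsUnique_lift F).choose

@[simp] theorem lift_p (v : Γ.V) : F.lift (Γ.universalFamily.p v) = F.p v :=
  (existsUnique_lift F).choose_spec.1.1 v

@[simp] theorem lift_s (e : Γ.E) : F.lift (Γ.universalFamily.s e) = F.s e :=
  (existsUnique_lift F).choose_spec.1.2 e

@[simp] theorem lift_pSum (S : Set Γ.V) : F.lift (Γ.universalFamily.pSum S) = F.pSum S :=
  ((F.lift : Γ.CStar →+ B).map_finsum_mem _ (Set.toFinite S)).trans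
    (finsum_mem_congr rfl fun v _ => F.lift_p v)

@[simp] theorem lift_qSum (T : Set Γ.E) : F.lift (Γ.universalFamily.qSum T) = F.qSum T :=
  ((F.lift : Γ.CStar →+ B).map_finsum_mem _ (Set.toFinite T)).trans
    (finsum_mem_congr rfl fun e _ => by
      rw [← F.lift_s e, ← map_star, ← map_mul]; rfl)

end Family

/-- Closed *-subalgebras of `C*(Γ)` that contain the generators are everything. -/
theorem mem_of_generators {Γ : FiniteHypergraph.{u}} (D : NonUnitalStarSubalgebra ℂ Γ.CStar)
    (hD : IsClosed (D : Set Γ.CStar)) (hp : ∀ v, Γ.universalFamily.p v ∈ D)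
    (hs : ∀ e, Γ.universalFamily.s e ∈ D) (x : Γ.CStar) : x ∈ D := by
  -- The generators form a family inside `D`. Its lift followed by the inclusion fixes the
  -- generators, hence is the identity.
  let F : Family Γ D := Family.ofInjective (fun _ : Unit => NonUnitalStarSubalgebraClass.subtype D)
    (fun _ _ h => Subtype.ext (h ())) (fun v => ⟨_, hp v⟩) (fun e => ⟨_, hs e⟩)
    (fun _ => Γ.universalFamily) (fun _ _ => rfl) (fun _ _ => rfl)
  have h : (NonUnitalStarSubalgebraClass.subtype D).comp F.lift = NonUnitalStarAlgHom.id ℂ _ :=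
    hom_ext (fun v => congrArg Subtype.val (F.lift_p v)) fun e => congrArg Subtype.val (F.lift_s e)
  have h2 : ((F.lift x : D) : Γ.CStar) = x := DFunLike.congr_fun h x
  have h3 := (F.lift x).2
  rwa [h2] at h3

/-- This provides a unit: the elements absorbed on both sides form a closed *-subalgebra that
contains the generators. -/
theorem one_mul_and_mul_one (Γ : FiniteHypergraph.{u}) (x : Γ.CStar) :
    Γ.universalFamily.pSum Set.univ * x = x ∧ x * Γ.universalFamily.pSum Set.univ = x := by
  set F := Γ.universalFamily with hF
  let D : NonUnitalStarSubalgebra ℂ Γ.CStar :=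
    { carrier := {x | F.pSum Set.univ * x = x ∧ x * F.pSum Set.univ = x}
      add_mem' := by
        rintro x y ⟨h1, h2⟩ ⟨h3, h4⟩
        exact ⟨by rw [mul_add, h1, h3], by rw [add_mul, h2, h4]⟩
      zero_mem' := ⟨mul_zero _, zero_mul _⟩
      mul_mem' := by
        rintro x y ⟨h1, h2⟩ ⟨h3, h4⟩
        exact ⟨by rw [← mul_assoc, h1], by rw [mul_assoc, h4]⟩
      smul_mem' := by
        rintro z x ⟨h1, h2⟩
        exact ⟨by rw [mul_smul_comm, h1], by rw [smul_mul_assoc, h2]⟩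
      star_mem' := by
        rintro x ⟨h1, h2⟩
        exact ⟨by simpa using congrArg star h2, by simpa using congrArg star h1⟩ }
  refine mem_of_generators D ?_ ?_ ?_ x
  · exact (isClosed_eq (continuous_const.mul continuous_id) continuous_id).inter
      (isClosed_eq (continuous_id.mul continuous_const) continuous_id)
  · exact fun v => ⟨F.pSum_mul_p_of_mem trivial, F.p_mul_pSum_of_mem trivial⟩
  · exact fun e => ⟨F.pSum_univ_mul_s e, F.s_mul_pSum_univ e⟩

end FiniteHypergraph

/-! ### Full corners and Morita equivalence -/

/-- `A` is isomorphic to the corner `P B P` for a full projection `P` of `B`. Fullness is meant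
algebraically, which is the same as topologically when `B` has a unit. -/
def IsFullCorner (A : Type v) (B : Type w) [NonUnitalCStarAlgebra A] [NonUnitalCStarAlgebra B] :
    Prop :=
  ∃ (φ : A →⋆ₙₐ[ℂ] B) (P : B), IsStarProjection P ∧ Function.Injective φ ∧
    (∀ x, x ∈ Set.range φ ↔ P * x * P = x) ∧
    Submodule.span ℂ {z | ∃ x y, x * P * y = z} = ⊤

theorem IsFullCorner.trans {A : Type*} {B : Type*} {C : Type*} [NonUnitalCStarAlgebra A]
    [NonUnitalCStarAlgebra B] [NonUnitalCStarAlgebra C] (h : IsFullCorner A B)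
    (h' : IsFullCorner B C) : IsFullCorner A C := by
  obtain ⟨φ, P, hP, hφ, hr, hs⟩ := h
  obtain ⟨χ, Q, hQ, hχ, hr', hs'⟩ := h'
  have hQ1 : ∀ b, Q * χ b = χ b := fun b => by
    rw [← (hr' (χ b)).1 ⟨b, rfl⟩, ← mul_assoc, ← mul_assoc, hQ.1]
  have hQ2 : ∀ b, χ b * Q = χ b := fun b => by
    rw [← (hr' (χ b)).1 ⟨b, rfl⟩, mul_assoc, hQ.1]
  refine ⟨χ.comp φ, χ P, hP.map χ, hχ.comp hφ, fun z => ⟨?_, fun hz => ?_⟩, ?_⟩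
  · rintro ⟨a, rfl⟩
    change χ P * χ (φ a) * χ P = χ (φ a)
    rw [← map_mul, ← map_mul, (hr (φ a)).1 ⟨a, rfl⟩]
  · obtain ⟨b, rfl⟩ := (hr' z).2 (by
      rw [← hz, ← mul_assoc, ← mul_assoc, hQ1, mul_assoc, hQ2])
    rw [← map_mul, ← map_mul] at hz
    obtain ⟨a, rfl⟩ := (hr b).2 (hχ hz)
    exact ⟨a, rfl⟩
  · rw [eq_top_iff, ← hs', Submodule.span_le]
    rintro _ ⟨x, y, rfl⟩
    -- `Q` lies in its own corner, so it is some `χ b`; writing `b` by means of the fullness of `P`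
    -- turns `x * Q * y` into a combination of products through `χ P`.
    obtain ⟨b, rfl⟩ := (hr' Q).2 (by rw [hQ.1, hQ.1])
    have hb : b ∈ Submodule.span ℂ {z | ∃ x y, x * P * y = z} := by rw [hs]; trivial
    rw [SetLike.mem_coe]
    clear hQ hr' hs' hQ1 hQ2
    induction hb using Submodule.span_induction with
    | mem b hb =>
      obtain ⟨x', y', rfl⟩ := hb
      refine Submodule.subset_span ⟨x * χ x', χ y' * y, ?_⟩
      simp only [map_mul, mul_assoc]
    | zero => simp
    | add b b' _ _ h1 h2 =>
      rw [map_add, mul_add, add_mul]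
      exact Submodule.add_mem _ h1 h2
    | smul c b _ h1 =>
      rw [map_smul, mul_smul_comm, smul_mul_assoc]
      exact Submodule.smul_mem _ _ h1

/-- Mutually inverse *-homomorphisms make an algebra a full corner in a unital one. -/
theorem IsFullCorner.of_inverse {A : Type*} {B : Type*} [NonUnitalCStarAlgebra A]
    [NonUnitalCStarAlgebra B] (φ : A →⋆ₙₐ[ℂ] B) (ψ : B →⋆ₙₐ[ℂ] A)
    (h : ψ.comp φ = NonUnitalStarAlgHom.id ℂ A) (h' : φ.comp ψ = NonUnitalStarAlgHom.id ℂ B)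
    {P : B} (hP : IsStarProjection P) (hP1 : ∀ x, P * x = x ∧ x * P = x) : IsFullCorner A B := by
  have h1 : ∀ x, ψ (φ x) = x := DFunLike.congr_fun h
  have h2 : ∀ x, φ (ψ x) = x := DFunLike.congr_fun h'
  refine ⟨φ, P, hP, Function.LeftInverse.injective h1,
    fun x => ⟨fun _ => by rw [(hP1 x).1, (hP1 x).2], fun _ => ⟨ψ x, h2 x⟩⟩, ?_⟩
  rw [eq_top_iff]
  exact fun x _ => Submodule.subset_span ⟨x, P, by rw [(hP1 x).2, (hP1 x).2]⟩

/-- Positivity of the left inner product must be witnessed inside the corner. The square root `c` of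
`x * star x` stays there: since `P` absorbs `c * c`, the element `c * P - c` has square norm zero.
-/
theorem IsStarProjection.exists_isSelfAdjoint_mul_self {B : Type*} [NonUnitalCStarAlgebra B]
    {P : B} (hP : IsStarProjection P) {x : B} (hx : P * x = x) :
    ∃ c : B, IsSelfAdjoint c ∧ c * c = x * star x ∧ P * c = c ∧ c * P = c := by
  let _ := CStarAlgebra.spectralOrder B
  have := CStarAlgebra.spectralOrderedRing B
  have h0 : 0 ≤ x * star x := mul_star_self_nonneg x
  have hc : IsSelfAdjoint (CFC.sqrt (x * star x)) := (CFC.sqrt_nonneg _).isSelfAdjoint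
  have hcc := CFC.sqrt_mul_sqrt_self (x * star x) h0
  set c := CFC.sqrt (x * star x)
  have h1 : P * (c * c) = c * c := by rw [hcc, ← mul_assoc, hx]
  have h2 : c * c * P = c * c := by
    simpa [hP.2.star_eq, hc.star_eq] using congrArg star h1
  have h3 : c * P = c := by
    refine sub_eq_zero.1 (CStarRing.star_mul_self_eq_zero_iff (c * P - c) |>.1 ?_)
    rw [star_sub, star_mul, hP.2.star_eq, hc.star_eq]
    have h4 : P * c * (c * P) = c * c := by rw [mul_assoc, ← mul_assoc c c, h2, h1]
    have h5 : P * c * c = c * c := by rw [mul_assoc, h1]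
    have h6 : c * (c * P) = c * c := by rw [← mul_assoc, h2]
    rw [mul_sub, sub_mul, sub_mul, h4, h5, h6, sub_self]
  exact ⟨c, hc, hcc, by simpa [hP.2.star_eq, hc.star_eq] using congrArg star h3, h3⟩

/-- The bimodule is `P B` with inner products `x * star y`, which lies in the corner and is pulled
back along `φ`, and `star x * y`. Left fullness is automatic, as `φ a` is itself paired with `P`;
right fullness is the fullness of `P`. -/
theorem IsFullCorner.isCStarMoritaEquivalent {A B : Type v} [NonUnitalCStarAlgebra A]
    [NonUnitalCStarAlgebra B] (h : IsFullCorner A B) : IsCStarMoritaEquivalent A B := by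
  obtain ⟨φ, P, hP, hφ, hr, hs⟩ := h
  let X : Submodule ℂ B :=
    { carrier := {x | P * x = x}
      add_mem' := fun {x y} hx hy => by
        change P * (x + y) = x + y
        rw [mul_add, hx, hy]
      zero_mem' := mul_zero P
      smul_mem' := fun c x hx => by
        change P * (c • x) = c • x
        rw [mul_smul_comm, hx] }
  have hX : IsClosed (X : Set B) :=
    isClosed_eq (continuous_const.mul continuous_id) continuous_id
  have : CompleteSpace X := hX.completeSpace_coe
  have hφP : ∀ a, P * φ a = φ a := fun a => by
    rw [← (hr (φ a)).1 ⟨a, rfl⟩, ← mul_assoc, ← mul_assoc, hP.1]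
  have hPφ : ∀ a, φ a * P = φ a := fun a => by
    rw [← (hr (φ a)).1 ⟨a, rfl⟩, mul_assoc, hP.1]
  have hx : ∀ x : X, P * x = x := fun x => x.2
  have hx' : ∀ x : X, star (x : B) * P = star (x : B) := fun x => by
    simpa [hP.2.star_eq] using congrArg star (hx x)
  have hinner : ∀ x y : X, ∃ a, φ a = x * star (y : B) := fun x y =>
    (hr _).2 (by rw [← mul_assoc, hx, mul_assoc, hx'])
  choose i hi using hinner
  refine ⟨X, inferInstance, inferInstance, this, ⟨
    { lsmul := LinearMap.mk₂ ℂ (fun a x => ⟨φ a * x, by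
          change P * (φ a * x) = φ a * x
          rw [← mul_assoc, hφP]⟩)
        (fun a b x => Subtype.ext (by simp [add_mul]))
        (fun c a x => Subtype.ext (by simp [smul_mul_assoc]))
        (fun a x y => Subtype.ext (by simp [mul_add]))
        (fun c a x => Subtype.ext (by simp [mul_smul_comm]))
      rsmul := LinearMap.mk₂ ℂ (fun b x => ⟨x * b, by
          change P * (x * b) = x * b
          rw [← mul_assoc, hx]⟩)
        (fun a b x => Subtype.ext (by simp [mul_add]))
        (fun c a x => Subtype.ext (by simp [mul_smul_comm]))
        (fun a x y => Subtype.ext (by simp [add_mul]))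
        (fun c a x => Subtype.ext (by simp [smul_mul_assoc]))
      innerL := LinearMap.mk₂'ₛₗ (RingHom.id ℂ) (starRingEnd ℂ) i
        (fun x y z => hφ (by simp [hi, add_mul]))
        (fun c x y => hφ (by simp [hi, smul_mul_assoc]))
        (fun x y z => hφ (by simp [hi, mul_add]))
        (fun c x y => hφ (by simp [hi, mul_smul_comm]))
      innerR := LinearMap.mk₂'ₛₗ (starRingEnd ℂ) (RingHom.id ℂ)
        (fun x y : X => star (x : B) * (y : B))
        (fun x y z => by simp [add_mul])
        (fun c x y => by simp [smul_mul_assoc])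
        (fun x y z => by simp [mul_add])
        (fun c x y => by simp [mul_smul_comm])
      lsmul_mul := fun a a' x => Subtype.ext (by simp [mul_assoc])
      rsmul_mul := fun a a' x => Subtype.ext (by simp [mul_assoc])
      lsmul_rsmul := fun a a' x => Subtype.ext (by simp [mul_assoc])
      innerL_lsmul := fun a x y => hφ (by simp [hi, mul_assoc])
      innerR_rsmul := fun b x y => by simp [mul_assoc]
      star_innerL := fun x y => hφ (by simp [hi, map_star])
      star_innerR := fun x y => by simp
      innerL_self_nonneg := fun x => by
        obtain ⟨c, hc, hcc, hPc, hcP⟩ := hP.exists_isSelfAdjoint_mul_self (hx x)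
        obtain ⟨d, rfl⟩ := (hr c).2 (by rw [hPc, hcP])
        exact ⟨d, hφ (by simp [hi, map_star, ← hcc, hc.star_eq])⟩
      innerR_self_nonneg := fun x => ⟨x, by simp⟩
      norm_sq_eq_innerL := fun x => by
        rw [← NonUnitalStarAlgHom.norm_map φ hφ]
        simp [hi, CStarRing.norm_self_mul_star, sq]
      norm_sq_eq_innerR := fun x => by simp [CStarRing.norm_star_mul_self, sq]
      dense_innerL := by
        have : ∀ a : A, a ∈ {a : A | ∃ x y : X, i x y = a} := fun a =>
          ⟨⟨φ a, hφP a⟩, ⟨P, hP.1⟩, hφ (by simp [hi, hP.2.star_eq, hPφ])⟩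
        refine dense_univ.mono fun a _ => Submodule.subset_span ?_
        exact this a
      dense_innerR := by
        have : (⊤ : Submodule ℂ B) ≤ Submodule.span ℂ {b | ∃ x y : X, star (x : B) * y = b} := by
          rw [← hs, Submodule.span_le]
          rintro _ ⟨x, y, rfl⟩
          refine Submodule.subset_span ⟨⟨P * star x, ?_⟩, ⟨P * y, ?_⟩, ?_⟩
          · change P * (P * star x) = P * star x
            rw [← mul_assoc, hP.1]
          · change P * (P * y) = P * y
            rw [← mul_assoc, hP.1]
          · simp only [star_mul, star_star, hP.2.star_eq]
            rw [mul_assoc, ← mul_assoc P P, hP.1, mul_assoc]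
        exact dense_univ.mono fun a _ => this trivial
      innerL_rsmul := fun b x y => hφ (by simp [hi, mul_assoc])
      innerR_lsmul := fun a x y => by simp [map_star, mul_assoc]
      innerL_lsmul_eq := fun x y z => Subtype.ext (by simp [hi, mul_assoc]) }⟩⟩

/-! ### Isomorphisms from pairs of families -/

namespace FiniteHypergraph

theorem IsCopy.of_injective {Δ : FiniteHypergraph.{u}} {V E : Type u} {W : Set V} {F : Set E}
    {r s : E → Set V} (φ : Δ.V → V) (ψ : Δ.E → E) (hφ : Function.Injective φ)
    (hψ : Function.Injective ψ) (hW : Set.range φ = W) (hF : Set.range ψ = F)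
    (hr : ∀ e, φ '' Δ.range e = r (ψ e)) (hs : ∀ e, φ '' Δ.source e = s (ψ e)) :
    Δ.IsCopy W F r s := by
  subst hW hF
  exact ⟨Equiv.ofInjective φ hφ, Equiv.ofInjective ψ hψ, fun e => ⟨hr e, hs e⟩⟩

/-- The two lifts are inverse to each other because they are so on generators; the corner is the
whole algebra, cut by its unit. -/
theorem isFullCorner_of_families {Γ Δ : FiniteHypergraph.{u}} (F : Family Δ Γ.CStar)
    (G : Family Γ Δ.CStar) (h1 : ∀ v, G.lift (F.p v) = Δ.universalFamily.p v)
    (h2 : ∀ e, G.lift (F.s e) = Δ.universalFamily.s e)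
    (h3 : ∀ v, F.lift (G.p v) = Γ.universalFamily.p v)
    (h4 : ∀ e, F.lift (G.s e) = Γ.universalFamily.s e) : IsFullCorner Δ.CStar Γ.CStar := by
  refine .of_inverse F.lift G.lift (hom_ext (fun v => ?_) fun e => ?_)
    (hom_ext (fun v => ?_) fun e => ?_) (Γ.universalFamily.isStarProjection_pSum Set.univ)
    Γ.one_mul_and_mul_one
  · exact (congrArg _ (F.lift_p v)).trans (h1 v)
  · exact (congrArg _ (F.lift_s e)).trans (h2 e)
  · exact (congrArg _ (G.lift_p v)).trans (h3 v)
  · exact (congrArg _ (G.lift_s e)).trans (h4 e)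

theorem isFullCorner_refl (Γ : FiniteHypergraph.{u}) : IsFullCorner Γ.CStar Γ.CStar :=
  isFullCorner_of_families Γ.universalFamily Γ.universalFamily (fun v => Family.lift_p _ v)
    (fun v => Family.lift_s _ v) (fun v => Family.lift_p _ v) (fun v => Family.lift_s _ v)

/-! ### Edge deletion -/

/-- The hypergraph without the edge `f`. -/
abbrev deleteEdge (Γ : FiniteHypergraph.{u}) (f : Γ.E) : FiniteHypergraph.{u} where
  V := Γ.V
  E := {e // e ≠ f}
  finiteV := inferInstance
  finiteE := inferInstance
  range e := Γ.range e
  source e := Γ.source e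
  source_nonempty e := Γ.source_nonempty e

theorem edgeDeletionAt_deleteEdge (Γ : FiniteHypergraph.{u}) (f : Γ.E) :
    Γ.EdgeDeletionAt (Γ.deleteEdge f) f :=
  .of_injective (Δ := Γ.deleteEdge f) id Subtype.val Function.injective_id Subtype.val_injective
    Set.range_id Subtype.range_val (fun _ => Set.image_id _) fun _ => Set.image_id _

/-- The vertices of the source of `f` emit no other edge, so they lie below the projection `s f`,
which in turn lies below their sum. -/
theorem Family.s_eq_pSum_source {Γ : FiniteHypergraph.{u}} {B : Type v} [NonUnitalCStarAlgebra B]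
    (F : Family Γ B) {f : Γ.E} (hr : Γ.range f = ∅)
    (hs : ∀ e, e ≠ f → Γ.source e ∩ Γ.source f = ∅) : F.s f = F.pSum (Γ.source f) := by
  have h : F.s f * F.pSum (Γ.source f) = F.pSum (Γ.source f) := by
    refine F.mul_pSum_eq_self fun v hv => F.mul_p_eq_self ⟨f, hv⟩ fun e he => ?_
    by_cases hef : e = f
    · rw [hef, F.s_mul_s_of_range_eq_empty hr]
    · exact absurd (Set.mem_inter he hv) (by rw [hs e hef]; exact Set.notMem_empty v)
  have h2 := congrArg star h
  rw [star_mul, F.star_s_of_range_eq_empty hr, F.star_pSum, F.pSum_source_mul_s] at h2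
  exact h2

-- The deleted generator is redundant, being the sum of the vertex projections of its source. After
-- the deletion these vertices emit nothing and impose no lower bound.
set_option maxHeartbeats 400000 in
theorem isFullCorner_deleteEdge (Γ : FiniteHypergraph.{u}) {f : Γ.E} (hr : Γ.range f = ∅)
    (hs : ∀ e, e ≠ f → Γ.source e ∩ Γ.source f = ∅) :
    IsFullCorner (Γ.deleteEdge f).CStar Γ.CStar := by
  classical
  set U := Γ.universalFamily with hU
  set U' := (Γ.deleteEdge f).universalFamily with hU'
  let F : Family (Γ.deleteEdge f) Γ.CStar := Family.ofMul (Γ := Γ.deleteEdge f)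
    U.p (fun e => U.s e.1) U.isStarProjection_p U.orthogonal_p
    (fun e he => U.star_mul_self_of_nonempty e he) (fun e he => U.star_mul_self_of_empty e he)
    (fun e e' h => U.star_mul_of_ne _ _ (Subtype.coe_injective.ne h))
    (fun e x h => U.mul_s_eq_self h)
    (fun v x ⟨e, he⟩ h => U.mul_p_eq_self ⟨e, he⟩ fun e' he' => h ⟨e', by
      rintro rfl
      exact absurd (Set.mem_inter he he') (by rw [hs e e.2]; exact Set.notMem_empty v)⟩ he')
  let S : Set (Γ.deleteEdge f).V := Γ.source f
  have hdisj : ∀ e : (Γ.deleteEdge f).E, Disjoint S ((Γ.deleteEdge f).source e) := fun e =>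
    (Set.disjoint_iff_inter_eq_empty.2 (hs e e.2)).symm
  let s : Γ.E → (Γ.deleteEdge f).CStar := fun e => if h : e = f then U'.pSum S else U'.s ⟨e, h⟩
  have sf : s f = U'.pSum S := dif_pos rfl
  have se : ∀ {e} (h : e ≠ f), s e = U'.s ⟨e, h⟩ := fun h => dif_neg h
  let G : Family Γ (Γ.deleteEdge f).CStar := Family.ofMul (Γ := Γ)
    U'.p s U'.isStarProjection_p U'.orthogonal_p
    (fun e he => by
      have h : e ≠ f := by
        rintro rfl
        rw [hr] at he
        exact Set.not_nonempty_empty he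
      rw [se h]
      exact U'.star_mul_self_of_nonempty ⟨e, h⟩ he)
    (fun e he => by
      by_cases h : e = f
      · rw [h, sf, U'.star_pSum, U'.pSum_mul_self]
      · rw [se h]
        exact U'.star_mul_self_of_empty ⟨e, h⟩ he)
    (fun e e' h => by
      by_cases h1 : e = f
      · have h2 : e' ≠ f := by rintro rfl; exact h h1
        rw [h1, sf, se h2, U'.star_pSum, U'.pSum_mul_s_of_disjoint (hdisj _)]
      · by_cases h2 : e' = f
        · rw [h2, sf, se h1]
          simpa using congrArg star (U'.pSum_mul_s_of_disjoint (hdisj ⟨e, h1⟩))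
        · rw [se h1, se h2]
          exact U'.star_mul_of_ne _ _ fun h3 => h (congrArg Subtype.val h3))
    (fun e x h => by
      by_cases h1 : e = f
      · subst h1
        rw [sf]
        exact U'.mul_pSum_eq_self h
      · rw [se h1]
        exact U'.mul_s_eq_self h)
    (fun v x ⟨e, he⟩ h => by
      by_cases h1 : e = f
      · subst h1
        have h2 := h e he
        have h3 : U'.pSum S * U'.p v = U'.p v := U'.pSum_mul_p_of_mem he
        rw [sf] at h2
        rw [← h3, ← mul_assoc, h2]
      · exact U'.mul_p_eq_self ⟨⟨e, h1⟩, he⟩ fun e' he' => by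
          have h2 := h e' he'
          rwa [se e'.2] at h2)
  refine isFullCorner_of_families F G (fun v => G.lift_p v) (fun e => ?_) (fun v => F.lift_p v)
    fun e => ?_
  · exact (G.lift_s e).trans (se e.2)
  · by_cases h : e = f
    · subst h
      change F.lift (s e) = _
      rw [sf, F.lift_pSum, U.s_eq_pSum_source hr hs]
      rfl
    · change F.lift (s e) = _
      rw [se h]
      exact F.lift_s ⟨e, h⟩

/-! ### Range decomposition -/

/-- The hypergraph in which the edge `f` is replaced by one edge for every vertex of its range. -/
abbrev decomposeRange (Γ : FiniteHypergraph.{u}) (f : Γ.E) : FiniteHypergraph.{u} where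
  V := Γ.V
  E := {e // e ≠ f} ⊕ Γ.range f
  finiteV := inferInstance
  finiteE := inferInstance
  range := Sum.elim (fun e => Γ.range e) (fun v => {v.1})
  source := Sum.elim (fun e => Γ.source e) (fun _ => Γ.source f)
  source_nonempty := by
    rintro (e | v)
    · exact Γ.source_nonempty e
    · exact Γ.source_nonempty f

theorem rangeDecomposition_decomposeRange (Γ : FiniteHypergraph.{u}) {f : Γ.E}
    (hf : (Γ.range f).Nonempty) : Γ.RangeDecomposition (Γ.decomposeRange f) := by
  refine ⟨f, hf, .of_injective (Δ := Γ.decomposeRange f) id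
    (Sum.map Subtype.val fun v => (f, v.1)) Function.injective_id ?_ Set.range_id ?_ ?_ ?_⟩
  · exact Subtype.val_injective.sumMap fun v w h => Subtype.ext (Prod.ext_iff.1 h).2
  · ext (e | ⟨e, v⟩)
    · simp
    · simp [eq_comm, and_comm]
  · rintro (e | v) <;> exact Set.image_id _
  · rintro (e | v) <;> exact Set.image_id _

-- The edge `(f, v)` corresponds to `s f * p v`, and `s f` is recovered as the sum of these pieces
-- over the range.
set_option maxHeartbeats 1000000 in
theorem isFullCorner_decomposeRange (Γ : FiniteHypergraph.{u}) {f : Γ.E}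
    (hf : (Γ.range f).Nonempty) : IsFullCorner (Γ.decomposeRange f).CStar Γ.CStar := by
  classical
  set U := Γ.universalFamily with hU
  set U' := (Γ.decomposeRange f).universalFamily with hU'
  have hUf := U.star_s_mul_s hf
  let F : Family (Γ.decomposeRange f) Γ.CStar := Family.ofMul (Γ := Γ.decomposeRange f)
    U.p (Sum.elim (fun e => U.s e.1) fun v => U.s f * U.p v.1) U.isStarProjection_p U.orthogonal_p
    (by
      rintro (e | v) h
      · exact U.star_mul_self_of_nonempty e h
      · refine Eq.trans ?_ (U.pSum_singleton v.1).symm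
        simp only [Sum.elim_inr, star_mul, U.star_p]
        rw [mul_assoc, ← mul_assoc (star _), hUf, U.pSum_mul_p_of_mem v.2, U.p_mul_p])
    (by
      rintro (e | v) h
      · exact U.star_mul_self_of_empty e h
      · exact absurd h (Set.singleton_ne_empty v.1))
    (by
      rintro (e | v) (e' | v') h
      · exact U.star_mul_of_ne _ _ fun h' => h (congrArg _ (Subtype.ext h'))
      · simp only [Sum.elim_inr, Sum.elim_inl]
        rw [← mul_assoc, U.star_mul_of_ne _ _ e.2, zero_mul]
      · simp only [Sum.elim_inr, Sum.elim_inl, star_mul]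
        rw [mul_assoc, U.star_mul_of_ne _ _ e'.2.symm, mul_zero]
      · simp only [Sum.elim_inr, star_mul, U.star_p]
        rw [mul_assoc, ← mul_assoc (star _), hUf, U.pSum_mul_p_of_mem v'.2,
          U.orthogonal_p _ _ fun h' => h (congrArg _ (Subtype.ext h'))])
    (by
      rintro (e | v) x h
      · exact U.mul_s_eq_self h
      · simp only [Sum.elim_inr]
        rw [← mul_assoc, U.mul_s_eq_self h])
    (by
      rintro v x ⟨e, he⟩ h
      refine U.mul_p_eq_self (by rcases e with e | w; exacts [⟨e, he⟩, ⟨f, he⟩]) fun e' he' => ?_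
      by_cases h1 : e' = f
      · subst h1
        rw [← U.s_mul_pSum_range hf, ← mul_assoc]
        refine U.mul_pSum_congr fun w hw => ?_
        rw [mul_assoc]
        exact h (Sum.inr ⟨w, hw⟩) he'
      · exact h (Sum.inl ⟨e', h1⟩) he')
  let _ : Fintype (Γ.range f) := Fintype.ofFinite _
  let t : (Γ.decomposeRange f).CStar := ∑ v : Γ.range f, U'.s (Sum.inr v)
  have hstar : ∀ v : Γ.range f, star (U'.s (Sum.inr v)) * U'.s (Sum.inr v) = U'.p v.1 := fun v =>
    (U'.star_mul_self_of_nonempty (Sum.inr v) (Set.singleton_nonempty v.1)).trans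
      (U'.pSum_singleton v.1)
  have hsp : ∀ v : Γ.range f, U'.s (Sum.inr v) * U'.p v.1 = U'.s (Sum.inr v) := fun v => by
    rw [← hstar, ← mul_assoc, U'.partialIsometry_s]
  have htp : ∀ v : Γ.range f, t * U'.p v.1 = U'.s (Sum.inr v) := fun v => by
    rw [Finset.sum_mul, Finset.sum_eq_single v, hsp]
    · intro w _ hw
      rw [← hsp w, mul_assoc, U'.orthogonal_p _ _ (Subtype.coe_injective.ne hw), mul_zero]
    · simp
  have htt : star t * t = U'.pSum (Γ.range f) := by
    rw [show U'.pSum (Γ.range f) = ∑ v : Γ.range f, U'.p v.1 from U'.pSum_eq_sum _, star_sum,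
      Finset.sum_mul]
    refine Finset.sum_congr rfl fun v _ => ?_
    rw [Finset.mul_sum, Finset.sum_eq_single v, hstar]
    · exact fun w _ hw => U'.star_mul_of_ne _ _ fun h => hw (Sum.inr_injective h).symm
    · simp
  have hst : ∀ e, star (U'.s (Sum.inl e)) * t = 0 := fun e => by
    rw [Finset.mul_sum]
    exact Finset.sum_eq_zero fun v _ => U'.star_mul_of_ne _ _ Sum.inl_ne_inr
  let s : Γ.E → (Γ.decomposeRange f).CStar := fun e => if h : e = f then t else U'.s (Sum.inl ⟨e, h⟩)
  have sf : s f = t := dif_pos rfl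
  have se : ∀ {e} (h : e ≠ f), s e = U'.s (Sum.inl ⟨e, h⟩) := fun h => dif_neg h
  let G : Family Γ (Γ.decomposeRange f).CStar := Family.ofMul (Γ := Γ)
    U'.p s U'.isStarProjection_p U'.orthogonal_p
    (fun e he => by
      by_cases h : e = f
      · subst h
        rw [sf]
        exact htt
      · rw [se h]
        exact U'.star_mul_self_of_nonempty (Sum.inl ⟨e, h⟩) he)
    (fun e he => by
      have h : e ≠ f := by
        rintro rfl
        rw [he] at hf
        exact Set.not_nonempty_empty hf
      rw [se h]
      exact U'.star_mul_self_of_empty (Sum.inl ⟨e, h⟩) he)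
    (fun e e' h => by
      by_cases h1 : e = f
      · have h2 : e' ≠ f := by rintro rfl; exact h h1
        rw [h1, sf, se h2]
        simpa using congrArg star (hst ⟨e', h2⟩)
      · by_cases h2 : e' = f
        · rw [h2, sf, se h1, hst]
        · rw [se h1, se h2]
          exact U'.star_mul_of_ne _ _ fun h3 => h (congrArg Subtype.val (Sum.inl_injective h3)))
    (fun e x h => by
      by_cases h1 : e = f
      · subst h1
        rw [sf, Finset.mul_sum]
        exact Finset.sum_congr rfl fun v _ => U'.mul_s_eq_self h
      · rw [se h1]
        exact U'.mul_s_eq_self h)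
    (fun v x ⟨e, he⟩ h => by
      refine U'.mul_p_eq_self ?_ ?_
      · by_cases h1 : e = f
        · subst h1
          exact ⟨Sum.inr ⟨_, hf.some_mem⟩, he⟩
        · exact ⟨Sum.inl ⟨e, h1⟩, he⟩
      · rintro (e' | w) he'
        · have h2 := h e' he'
          rwa [se e'.2] at h2
        · have h2 := h f he'
          rw [sf] at h2
          rw [← htp, ← mul_assoc, h2])
  refine isFullCorner_of_families F G (fun v => G.lift_p v) ?_ (fun v => F.lift_p v) fun e => ?_
  · rintro (e | v)
    · exact (G.lift_s e).trans (se e.2)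
    · change G.lift (U.s f * U.p v.1) = _
      rw [map_mul, G.lift_s, G.lift_p, ← htp]
      exact congrArg (· * U'.p v.1) sf
  · by_cases h : e = f
    · subst h
      change F.lift (s e) = _
      rw [sf, map_sum, ← U.s_mul_pSum_range hf, U.pSum_eq_sum, Finset.mul_sum]
      exact Finset.sum_congr rfl fun v _ => F.lift_s (Sum.inr v)
    · change F.lift (s e) = _
      rw [se h]
      exact F.lift_s (Sum.inl ⟨e, h⟩)

/-! ### Source separation -/

/-- The hypergraph in which the edges of `F` start in a copy `none` of the vertex `w`. -/
abbrev separateSource (Γ : FiniteHypergraph.{u}) (F : Set Γ.E) (w : Γ.V) :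
    FiniteHypergraph.{u} where
  V := Option Γ.V
  E := Γ.E
  finiteV := inferInstance
  finiteE := inferInstance
  -- Both `none` and `some w` are sent back to `w`, so the preimage gains `none` exactly when the
  -- range contains `w`.
  range e := (fun o => o.getD w) ⁻¹' Γ.range e
  source e := {o | o.elim (e ∈ F) fun v => v ∈ Γ.source e ∧ (e ∈ F → v ≠ w)}
  source_nonempty e := by
    by_cases h : e ∈ F
    · exact ⟨none, h⟩
    · obtain ⟨v, hv⟩ := Γ.source_nonempty e
      exact ⟨some v, hv, fun h' => absurd h' h⟩

theorem sourceSeparation_separateSource (Γ : FiniteHypergraph.{u}) {F : Set Γ.E} {w : Γ.V}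
    (hF : F.Nonempty) (hw : F ⊂ {e | w ∈ Γ.source e}) :
    Γ.SourceSeparation (Γ.separateSource F w) := by
  refine ⟨F, w, hF, hw, .of_injective (Δ := Γ.separateSource F w) id id Function.injective_id
    Function.injective_id Set.range_id Set.range_id (fun e => ?_) fun e => ?_⟩
  · rw [Set.image_id]
    ext (_ | v)
    · by_cases h : w ∈ Γ.range e <;> simp [h]
    · by_cases h : w ∈ Γ.range e <;> simp [h]
  · rw [Set.image_id]
    ext (_ | v)
    · by_cases h : e ∈ F <;> simp [h]
    · by_cases h : e ∈ F <;> simp [h]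

/-- Let `q` be the range projection of `F`; it lies below the projection of `S`. The remaining edges
at `w` vanish against `S \ {w}`, and so does `p w`; since all edges at `w` together absorb `p w`,
also `q * p w` vanishes against `S \ {w}`. Hence `q * p w = p w * q * p w`, which is self-adjoint.
-/
theorem Family.commute_qSum_p {Γ : FiniteHypergraph.{u}} {B : Type v} [NonUnitalCStarAlgebra B]
    (U : Family Γ B) {F : Set Γ.E} {w : Γ.V} {S : Set Γ.V} (hwS : w ∈ S)
    (hF : ∀ e ∈ F, w ∈ Γ.source e ∧ Γ.source e ⊆ S) (hF0 : F.Nonempty)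
    (hF' : ∀ e, e ∉ F → w ∈ Γ.source e → Γ.source e ∩ S ⊆ {w}) :
    U.qSum F * U.p w = U.p w * U.qSum F := by
  obtain ⟨e₀, he₀⟩ := hF0
  have hq : U.pSum S * U.qSum F = U.qSum F :=
    U.mul_qSum_eq_self fun e he => U.pSum_mul_s_of_subset (hF e he).2
  have h1 : U.qSum F + U.qSum ({e | w ∈ Γ.source e} \ F) = U.qSum {e | w ∈ Γ.source e} := by
    rw [← U.qSum_union Set.disjoint_sdiff_right, Set.union_sdiff_cancel (show F ⊆ {e | w ∈ Γ.source e} from fun e he => (hF e he).1)]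
  have h2 := U.qSum_mul_p (hF e₀ he₀).1
  have h3 : U.pSum (S \ {w}) * U.qSum ({e | w ∈ Γ.source e} \ F) = 0 :=
    U.mul_qSum_eq_zero fun e he => U.pSum_mul_s_of_disjoint
      (Set.disjoint_left.2 fun v hv hv' => hv.2 (hF' e he.2 he.1 ⟨hv', hv.1⟩))
  have h4 : U.pSum (S \ {w}) * (U.qSum F * U.p w) = 0 := by
    have h5 : U.pSum (S \ {w}) * U.p w = 0 := U.pSum_mul_p_of_notMem (by simp)
    rw [← h2, ← h1, add_mul, mul_add, ← mul_assoc _ (U.qSum ({e | w ∈ Γ.source e} \ F)), h3,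
      zero_mul, add_zero] at h5
    exact h5
  have h6 : U.qSum F * U.p w = U.p w * (U.qSum F * U.p w) := by
    conv_lhs => rw [← hq, ← U.pSum_sdiff_add hwS, mul_assoc, add_mul, h4, zero_add]
  have h7 := congrArg star h6
  simp only [star_mul, U.star_p, U.star_qSum] at h7
  rw [h6, h7, mul_assoc]

-- By commutation `a = p w * q` and `p w - a` are orthogonal projections, and they serve as the new
-- vertex `none` and the vertex `some w`. Conversely `p v` is the sum over the copies of `v`. The
-- partial isometries do not change.
set_option maxHeartbeats 1000000 in
theorem isFullCorner_separateSource (Γ : FiniteHypergraph.{u}) {F : Set Γ.E} {w : Γ.V}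
    {S : Set Γ.V} (hwS : w ∈ S) (hF : ∀ e ∈ F, w ∈ Γ.source e ∧ Γ.source e ⊆ S)
    (hF0 : F.Nonempty) (hF' : ∀ e, e ∉ F → w ∈ Γ.source e → Γ.source e ∩ S ⊆ {w})
    (hF1 : ∃ e, e ∉ F ∧ w ∈ Γ.source e) :
    IsFullCorner (Γ.separateSource F w).CStar Γ.CStar := by
  classical
  set U := Γ.universalFamily with hU
  set U' := (Γ.separateSource F w).universalFamily with hU'
  have hcomm := U.commute_qSum_p hwS hF hF0 hF'
  obtain ⟨e₀, he₀⟩ := hF0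
  obtain ⟨e₁, he₁, he₁'⟩ := hF1
  set q := U.qSum F with hq
  set a := U.p w * q with ha
  have haP : IsStarProjection a :=
    (U.isStarProjection_p w).mul (U.isStarProjection_qSum F) hcomm.symm
  have hwa : U.p w * a = a := by rw [ha, ← mul_assoc, U.p_mul_p]
  have haw : a * U.p w = a := by rw [ha, mul_assoc, hcomm, ← mul_assoc, U.p_mul_p]
  have hbP : IsStarProjection (U.p w - a) :=
    haP.sub_of_mul_eq_right (U.isStarProjection_p w) hwa
  have hva : ∀ v, v ≠ w → U.p v * a = 0 := fun v h => by
    rw [ha, ← mul_assoc, U.orthogonal_p v w h, zero_mul]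
  have hav : ∀ v, v ≠ w → a * U.p v = 0 := fun v h => by
    rw [← hcomm, mul_assoc, U.orthogonal_p w v h.symm, mul_zero]
  let p : Option Γ.V → Γ.CStar :=
    fun o => o.elim a fun v => if v = w then U.p w - a else U.p v
  have pn : p none = a := rfl
  have pw : p (some w) = U.p w - a := if_pos rfl
  have pv : ∀ {v}, v ≠ w → p (some v) = U.p v := fun h => if_neg h
  have hsum1 : ∀ v, ∑ᶠ o ∈ (fun o : Option Γ.V => o.getD w) ⁻¹' {v}, p o = U.p v := fun v => by
    by_cases h : v = w
    · subst h
      have : (fun o : Option Γ.V => o.getD v) ⁻¹' {v} = {none, some v} := by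
        ext (_ | u) <;> simp
      rw [this, finsum_mem_pair (Option.some_ne_none v).symm, pn, pw, add_sub_cancel]
    · have : (fun o : Option Γ.V => o.getD w) ⁻¹' {v} = {some v} := by
        ext (_ | u) <;> simp [Ne.symm h]
      rw [this, finsum_mem_singleton, pv h]
  have hsum : ∀ R : Set Γ.V, ∑ᶠ o ∈ (fun o : Option Γ.V => o.getD w) ⁻¹' R, p o = U.pSum R :=
    fun R => by
      rw [← Set.biUnion_preimage_singleton, finsum_mem_biUnion
        (fun _ _ _ _ h => Disjoint.preimage _ (Set.disjoint_singleton.2 h)) (Set.toFinite _)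
        fun _ _ => Set.toFinite _]
      exact finsum_mem_congr rfl fun v _ => hsum1 v
  let G₁ : Family (Γ.separateSource F w) Γ.CStar := Family.ofMul (Γ := Γ.separateSource F w) p U.s
    (by
      rintro (_ | v)
      · exact haP
      · by_cases h : v = w
        · subst h
          rwa [pw]
        · rw [pv h]
          exact U.isStarProjection_p v)
    (by
      rintro (_ | v) (_ | v') h
      · exact absurd rfl h
      · by_cases h' : v' = w
        · subst h'
          rw [pn, pw, mul_sub, haw, haP.1, sub_self]
        · rw [pn, pv h', hav _ h']
      · by_cases h' : v = w
        · subst h'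
          rw [pn, pw, sub_mul, hwa, haP.1, sub_self]
        · rw [pn, pv h', hva _ h']
      · have hvv : v ≠ v' := fun h' => h (congrArg some h')
        by_cases h1 : v = w
        · have h2 : v' ≠ w := by rintro rfl; exact hvv h1
          subst h1
          rw [pw, pv h2, sub_mul, hav _ h2, U.orthogonal_p _ _ hvv, sub_zero]
        · by_cases h2 : v' = w
          · subst h2
            rw [pw, pv h1, mul_sub, hva _ h1, U.orthogonal_p _ _ hvv, sub_zero]
          · rw [pv h1, pv h2, U.orthogonal_p _ _ hvv])
    (fun e he => by
      rw [hsum (Γ.range e)]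
      refine U.star_s_mul_s ?_
      obtain ⟨o, ho⟩ := he
      exact ⟨_, ho⟩)
    (fun e he => U.star_mul_self_of_empty e (by
      rw [Set.eq_empty_iff_forall_notMem] at he ⊢
      exact fun v hv => he (some v) hv))
    U.star_mul_of_ne
    (fun e x h => by
      by_cases hw : w ∈ Γ.source e
      -- `b` is the piece of `p w` at which `e` now starts: `a` for edges of `F`, `p w - a` for the
      -- others.
      · have hb : ∃ b, x * b = b ∧ U.p w * U.s e = b * U.s e := by
          by_cases heF : e ∈ F
          · refine ⟨a, h none heF, ?_⟩
            rw [ha, mul_assoc, hq, U.qSum_mul_s_of_mem heF]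
          · refine ⟨U.p w - a, ?_, ?_⟩
            · rw [← pw]
              exact h (some w) ⟨hw, fun h' => absurd h' heF⟩
            · rw [sub_mul, ha, mul_assoc (U.p w), hq, U.qSum_mul_s_of_notMem heF, mul_zero,
                sub_zero]
        obtain ⟨b, hb, hb'⟩ := hb
        have h1 : x * U.pSum (Γ.source e \ {w}) = U.pSum (Γ.source e \ {w}) :=
          U.mul_pSum_eq_self fun v hv => by
            have h2 := h (some v) ⟨hv.1, fun _ => hv.2⟩
            rwa [pv hv.2] at h2
        have h3 : U.s e = U.pSum (Γ.source e \ {w}) * U.s e + b * U.s e := by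
          rw [← hb', ← add_mul, U.pSum_sdiff_add hw, U.pSum_source_mul_s]
        rw [h3, mul_add, ← mul_assoc, h1, ← mul_assoc, hb]
      · refine U.mul_s_eq_self fun v hv => ?_
        have hvw : v ≠ w := by rintro rfl; exact hw hv
        have h2 := h (some v) ⟨hv, fun _ => hvw⟩
        rwa [pv hvw] at h2)
    (by
      rintro (_ | v) x ⟨e, he⟩ h
      · have h1 : x * q = q := U.mul_qSum_eq_self h
        rw [pn, ← hcomm, ← mul_assoc, h1]
      · by_cases hvw : v = w
        · subst hvw
          have h1 : U.qSum F + U.qSum ({e | v ∈ Γ.source e} \ F) =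
              U.qSum {e | v ∈ Γ.source e} := by
            rw [← U.qSum_union Set.disjoint_sdiff_right,
              Set.union_sdiff_cancel
                (show F ⊆ {e | v ∈ Γ.source e} from fun e he => (hF e he).1)]
          -- The complementary piece is cut out by the edges at the vertex that do not belong to
          -- `F`.
          have h2 : U.p v - a = U.qSum ({e | v ∈ Γ.source e} \ F) * U.p v := by
            rw [eq_comm, eq_sub_iff_add_eq, ← hcomm, add_comm, ← add_mul, hq, h1,
              U.qSum_mul_p he₁']
          rw [pw, h2, ← mul_assoc, U.mul_qSum_eq_self]
          exact fun e he => h e ⟨he.1, fun h' => absurd h' he.2⟩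
        · rw [pv hvw]
          exact U.mul_p_eq_self ⟨e, he.1⟩ fun e' he' => h e' ⟨he', fun _ => hvw⟩)
  have hsub : ∀ e o, o ∈ (Γ.separateSource F w).source e → o.getD w ∈ Γ.source e := by
    rintro e (_ | v) h
    · exact (hF e h).1
    · exact h.1
  let π : Option Γ.V → Γ.V := fun o => o.getD w
  let G₂ : Family Γ (Γ.separateSource F w).CStar := Family.ofMul (Γ := Γ)
    (fun v => U'.pSum (π ⁻¹' {v})) U'.s (fun v => U'.isStarProjection_pSum _)
    (fun v v' h => U'.pSum_mul_pSum_of_disjoint (Disjoint.preimage _ (Set.disjoint_singleton.2 h)))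
    (fun e he => by
      refine (U'.star_s_mul_s (e := e) ?_).trans ?_
      · obtain ⟨v, hv⟩ := he
        exact ⟨some v, hv⟩
      · change U'.pSum (π ⁻¹' Γ.range e) = _
        rw [← Set.biUnion_preimage_singleton]
        exact finsum_mem_biUnion
          (fun _ _ _ _ h => Disjoint.preimage _ (Set.disjoint_singleton.2 h)) (Set.toFinite _)
          fun _ _ => Set.toFinite _)
    (fun e he => U'.star_mul_self_of_empty e (by
      change π ⁻¹' Γ.range e = ∅
      rw [he, Set.preimage_empty]))
    U'.star_mul_of_ne
    (fun e x h => U'.mul_s_eq_self fun o ho => by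
      have h1 : U'.pSum (π ⁻¹' {π o}) * U'.p o = U'.p o := U'.pSum_mul_p_of_mem rfl
      rw [← h1, ← mul_assoc, h _ (hsub e o ho)])
    (fun v x ⟨e, he⟩ h => U'.mul_pSum_eq_self fun o ho => by
      refine U'.mul_p_eq_self ?_ fun e' he' => h e' (by
        rw [← show π o = v from ho]
        exact hsub e' o he')
      -- The lower bound is available only at vertices that emit an edge: `e₀` in `F` serves the new
      -- vertex and `e₁` outside `F` the old one.
      rcases o with _ | v'
      · exact ⟨e₀, he₀⟩
      · obtain rfl : v' = v := ho
        by_cases hvw : v' = w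
        · subst hvw
          exact ⟨e₁, he₁', fun h' => absurd h' he₁⟩
        · exact ⟨e, he, fun _ => hvw⟩)
  have hpreim : U'.pSum (π ⁻¹' {w}) = U'.p none + U'.p (some w) := by
    have : π ⁻¹' {w} = {none, some w} := by ext (_ | u) <;> simp [π]
    rw [this]
    exact finsum_mem_pair (Option.some_ne_none w).symm
  have hpreim' : ∀ v, v ≠ w → U'.pSum (π ⁻¹' {v}) = U'.p (some v) := fun v h => by
    have : π ⁻¹' {v} = {some v} := by ext (_ | u) <;> simp [π, Ne.symm h]
    rw [this]
    exact U'.pSum_singleton _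
  -- The new vertex emits only edges of `F` and `some w` none of them, so `q` separates the two
  -- copies of `w`.
  have hqn : U'.p none * U'.qSum F = U'.p none := by
    have h1 : U'.qSum F * U'.p none = U'.p none := U'.qSum_mul_p (v := none) (e := e₀) he₀
    have h2 := congrArg star h1
    rwa [star_mul, U'.star_p, U'.star_qSum] at h2
  have hqw : U'.p (some w) * U'.qSum F = 0 := by
    have h1 := U'.qSum_mul_p (v := some w) (e := e₁) ⟨he₁', fun h => absurd h he₁⟩
    have h2 : U'.qSum F * U'.p (some w) = 0 := by
      rw [← h1, ← mul_assoc, U'.qSum_mul_qSum_of_disjoint, zero_mul]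
      exact Set.disjoint_left.2 fun e he he' => he'.2 he rfl
    have h3 := congrArg star h2
    rwa [star_mul, U'.star_p, U'.star_qSum, star_zero] at h3
  have hGa : G₂.lift a = U'.p none := by
    rw [ha, hq, map_mul, G₂.lift_p, G₂.lift_qSum]
    change U'.pSum (π ⁻¹' {w}) * U'.qSum F = _
    rw [hpreim, add_mul, hqn, hqw, add_zero]
  refine isFullCorner_of_families G₁ G₂ ?_ (fun e => G₂.lift_s e) (fun v => ?_) fun e => G₁.lift_s e
  · rintro (_ | v)
    · exact hGa
    · change G₂.lift (p (some v)) = _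
      by_cases h : v = w
      · subst h
        rw [pw, map_sub, hGa, G₂.lift_p]
        change U'.pSum (π ⁻¹' {v}) - _ = _
        rw [hpreim, add_sub_cancel_left]
      · rw [pv h, G₂.lift_p]
        exact hpreim' v h
  · change G₁.lift (U'.pSum (π ⁻¹' {v})) = _
    rw [G₁.lift_pSum]
    exact hsum1 v

/-! ### Backward contraction: the family inside the corner -/

/-- The edge `f` with range `{w}` satisfies the conditions for a backward contraction. -/
structure IsBackwardContractible (Γ : FiniteHypergraph.{u}) (f : Γ.E) (w : Γ.V) : Prop where
  range_eq : Γ.range f = {w}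
  disjoint_source : ∀ e, e ≠ f → Disjoint (Γ.source e) (Γ.source f)
  disjoint_range : ∀ e, w ∈ Γ.range e → Disjoint (Γ.range e) (Γ.source f)

theorem IsBackwardContractible.notMem {Γ : FiniteHypergraph.{u}} {f : Γ.E} {w : Γ.V}
    (h : Γ.IsBackwardContractible f w) : w ∉ Γ.source f := by
  have hw : w ∈ Γ.range f := by rw [h.range_eq]; rfl
  exact (h.disjoint_range f hw).notMem_of_mem_left hw

/-- The hypergraph in which the edge `f` with range `{w}` is contracted backward. -/
abbrev contractBackward (Γ : FiniteHypergraph.{u}) (f : Γ.E) (w : Γ.V) (hw : w ∉ Γ.source f) :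
    FiniteHypergraph.{u} where
  V := {v // v ≠ w}
  E := {e // e ≠ f}
  finiteV := inferInstance
  finiteE := inferInstance
  range e := {v | v.1 ∈ Γ.range e ∨ w ∈ Γ.range e ∧ v.1 ∈ Γ.source f}
  source e := {v | v.1 ∈ Γ.source e ∨ w ∈ Γ.source e ∧ v.1 ∈ Γ.source f}
  source_nonempty e := by
    obtain ⟨v, hv⟩ := Γ.source_nonempty e
    by_cases h : v = w
    · obtain ⟨v', hv'⟩ := Γ.source_nonempty f
      exact ⟨⟨v', by rintro rfl; exact hw hv'⟩, .inr ⟨h ▸ hv, hv'⟩⟩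
    · exact ⟨⟨v, h⟩, .inl hv⟩

open Classical in
theorem backwardContraction_contractBackward (Γ : FiniteHypergraph.{u}) {f : Γ.E} {w : Γ.V}
    (h : Γ.IsBackwardContractible f w) : Γ.BackwardContraction (Γ.contractBackward f w h.notMem) := by
  have key : ∀ S : Set Γ.V, (Subtype.val : {v // v ≠ w} → Γ.V) ''
      {v | v.1 ∈ S ∨ w ∈ S ∧ v.1 ∈ Γ.source f} =
      if w ∈ S then (S \ {w}) ∪ Γ.source f else S := fun S => by
    have hw := h.notMem
    ext v
    by_cases hS : w ∈ S
    · rw [if_pos hS]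
      simp only [hS, true_and, Set.mem_image, Set.mem_ofPred_eq, Subtype.exists,
        exists_and_right, exists_eq_right, Set.mem_union, Set.mem_sdiff, Set.mem_singleton_iff]
      constructor
      · rintro ⟨h1, h2 | h2⟩
        exacts [.inl ⟨h2, h1⟩, .inr h2]
      · rintro (⟨h1, h2⟩ | h2)
        exacts [⟨h2, .inl h1⟩, ⟨by rintro rfl; exact hw h2, .inr h2⟩]
    · rw [if_neg hS]
      simp only [hS, false_and, or_false, Set.mem_image, Set.mem_ofPred_eq, Subtype.exists,
        exists_and_right, exists_eq_right]
      exact ⟨fun h1 => h1.2, fun h1 => ⟨by rintro rfl; exact hS h1, h1⟩⟩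
  refine ⟨f, w, h.range_eq, fun e he => ?_, ?_, .of_injective
    (Δ := Γ.contractBackward f w h.notMem) Subtype.val Subtype.val Subtype.val_injective
    Subtype.val_injective Subtype.range_val Subtype.range_val (fun e => ?_) fun e => ?_⟩
  · by_contra hef
    exact Set.not_nonempty_iff_eq_empty.2 (Set.disjoint_iff_inter_eq_empty.1
      (h.disjoint_source e hef)) he
  · rintro ⟨e, he, hw⟩
    exact Set.not_nonempty_iff_eq_empty.2 (Set.disjoint_iff_inter_eq_empty.1
      (h.disjoint_range e hw)) he
  · exact key _
  · exact key _

namespace Family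

variable {Γ : FiniteHypergraph.{u}} {B : Type v} [NonUnitalCStarAlgebra B] (U : Family Γ B)
  {f : Γ.E} {w : Γ.V}

theorem star_s_mul_s_eq_p (h : Γ.IsBackwardContractible f w) : star (U.s f) * U.s f = U.p w := by
  rw [U.star_s_mul_s (by rw [h.range_eq]; exact Set.singleton_nonempty w), h.range_eq,
    U.pSum_singleton]

/-- `f` is the only edge emitted at the vertices of its source, so the upper and lower bounds for
its range projection coincide. -/
theorem s_mul_star_s_eq_pSum (h : Γ.IsBackwardContractible f w) : U.s f * star (U.s f) = U.pSum (Γ.source f) := by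
  have h1 : U.s f * star (U.s f) * U.pSum (Γ.source f) = U.pSum (Γ.source f) := by
    refine U.mul_pSum_eq_self fun v hv => U.mul_p_eq_self ⟨f, hv⟩ fun e he => ?_
    by_cases hef : e = f
    · rw [hef, U.partialIsometry_s]
    · exact absurd hv ((h.disjoint_source e hef).notMem_of_mem_left he)
  have h2 := congrArg star h1
  rwa [star_mul, star_mul, star_star, U.star_pSum, ← mul_assoc, U.pSum_source_mul_s] at h2

theorem s_mul_p_of_ne (h : Γ.IsBackwardContractible f w) {v : Γ.V} (hv : v ≠ w) : U.s f * U.p v = 0 := by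
  rw [← U.partialIsometry_s f, mul_assoc _ (star _), U.star_s_mul_s_eq_p h, mul_assoc,
    U.orthogonal_p w v hv.symm, mul_zero]

theorem s_mul_p_eq_self (h : Γ.IsBackwardContractible f w) : U.s f * U.p w = U.s f := by
  rw [← U.star_s_mul_s_eq_p h, ← mul_assoc, U.partialIsometry_s]

theorem s_mul_pSum_compl (h : Γ.IsBackwardContractible f w) : U.s f * U.pSum {w}ᶜ = 0 :=
  U.mul_pSum_eq_zero fun _ hv => U.s_mul_p_of_ne h hv

theorem pSum_compl_mul_s (h : Γ.IsBackwardContractible f w) : U.pSum {w}ᶜ * U.s f = U.s f :=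
  U.pSum_mul_s_of_subset fun v hv => by rintro rfl; exact h.notMem hv

theorem p_mul_s (h : Γ.IsBackwardContractible f w) : U.p w * U.s f = 0 := U.p_mul_s_of_notMem h.notMem

/-- The element that moves the vertex `w` to the source of `f`. -/
noncomputable def transport (U : Family Γ B) (f : Γ.E) (w : Γ.V) : B := U.s f + U.pSum {w}ᶜ

theorem transport_mul_p_of_ne (h : Γ.IsBackwardContractible f w) {v : Γ.V} (hv : v ≠ w) : U.transport f w * U.p v = U.p v := by
  rw [transport, add_mul, U.s_mul_p_of_ne h hv, U.pSum_mul_p_of_mem hv, zero_add]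

theorem transport_mul_p (h : Γ.IsBackwardContractible f w) : U.transport f w * U.p w = U.s f := by
  rw [transport, add_mul, U.s_mul_p_eq_self h, U.pSum_mul_p_of_notMem (by simp), add_zero]

/-- The transport need not be a partial isometry. The excess `s f + star (s f)` is harmless because
it vanishes between the other edges, by `star_s_mul_transport` and `s_mul_transport`. -/
theorem star_transport_mul_transport (h : Γ.IsBackwardContractible f w) :
    star (U.transport f w) * U.transport f w = U.pSum Set.univ + (U.s f + star (U.s f)) := by
  have h1 := congrArg star (U.pSum_compl_mul_s h)
  rw [star_mul, U.star_pSum] at h1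
  rw [transport, star_add, U.star_pSum, add_mul, mul_add, mul_add, U.star_s_mul_s_eq_p h, h1,
    U.pSum_compl_mul_s h, U.pSum_mul_self, ← U.pSum_sdiff_add (Set.mem_univ w),
    ← Set.compl_eq_univ_sdiff]
  abel

theorem star_s_mul_transport (h : Γ.IsBackwardContractible f w) {e e' : Γ.E} (he : e ≠ f)
    (he' : e' ≠ f) :
    star (U.s e') * (star (U.transport f w) * (U.transport f w * U.s e)) =
      star (U.s e') * U.s e := by
  rw [← mul_assoc (star (U.transport f w)), U.star_transport_mul_transport h, add_mul, add_mul,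
    U.pSum_mul_s_of_subset (Set.subset_univ _), U.star_mul_of_ne _ _ (Ne.symm he), add_zero,
    mul_add, ← mul_assoc (star (U.s e')), U.star_mul_of_ne _ _ he', zero_mul, add_zero]

/-- If the range of `e` is empty, `s e` is self-adjoint and orthogonality of edges applies. If it
contains `w`, it is disjoint from the source of `f`. Otherwise `p w`, the right support of `s f`,
kills `star (s e)`. -/
theorem s_mul_s_mul_star_s (h : Γ.IsBackwardContractible f w) {e : Γ.E} (he : e ≠ f) :
    U.s e * (U.s f * star (U.s e)) = 0 := by
  rcases (Γ.range e).eq_empty_or_nonempty with h0 | h0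
  · rw [← mul_assoc, ← U.star_s_of_range_eq_empty h0, U.star_mul_of_ne _ _ he, zero_mul]
  by_cases hw : w ∈ Γ.range e
  · rw [← mul_assoc, ← U.s_mul_pSum_range h0, mul_assoc (U.s e),
      U.pSum_mul_s_of_disjoint (h.disjoint_range e hw), mul_zero, zero_mul]
  · have h1 : U.s e * U.p w = 0 := by
      rw [← U.s_mul_pSum_range h0, mul_assoc, U.pSum_mul_p_of_notMem hw, mul_zero]
    have h2 := congrArg star h1
    rw [star_mul, U.star_p, star_zero] at h2
    rw [← U.s_mul_p_eq_self h, mul_assoc, h2, mul_zero, mul_zero]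

theorem s_mul_transport (h : Γ.IsBackwardContractible f w) {e : Γ.E} (he : e ≠ f) :
    U.s e * (star (U.transport f w) * (U.transport f w * star (U.s e))) = U.s e * star (U.s e) := by
  have h1 := congrArg star (U.s_mul_s_mul_star_s h he)
  simp only [star_mul, star_star, star_zero, mul_assoc] at h1
  rw [← mul_assoc (star (U.transport f w)), U.star_transport_mul_transport h, add_mul, add_mul,
    mul_add, mul_add, U.s_mul_s_mul_star_s h he, h1, add_zero, add_zero, ← mul_assoc,
    U.s_mul_pSum_of_subset (Set.subset_univ _) fun _ => Set.subset_univ _]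

theorem transport_mul_pSum (h : Γ.IsBackwardContractible f w) {S : Set Γ.V} (hw : w ∉ S) :
    U.transport f w * U.pSum S = U.pSum S := by
  refine U.mul_pSum_eq_self fun v hv => U.transport_mul_p_of_ne h ?_
  rintro rfl
  exact hw hv

theorem transport_mul_pSum_mul_star (h : Γ.IsBackwardContractible f w) {S : Set Γ.V} (hw : w ∉ S) :
    U.transport f w * U.pSum S * star (U.transport f w) = U.pSum S := by
  have h1 := congrArg star (U.transport_mul_pSum h hw)
  rw [star_mul, U.star_pSum] at h1
  rw [U.transport_mul_pSum h hw, h1]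

theorem finsum_p_subtype (S : Set {v // v ≠ w}) :
    ∑ᶠ v ∈ S, U.p v.1 = U.pSum (Subtype.val '' S) :=
  (finsum_mem_image Subtype.val_injective.injOn).symm

theorem transport_conj_pSum_range (h : Γ.IsBackwardContractible f w) (e : Γ.E) :
    U.transport f w * U.pSum (Γ.range e) * star (U.transport f w) =
      U.pSum ((Subtype.val : {v // v ≠ w} → Γ.V) ''
        {v | v.1 ∈ Γ.range e ∨ w ∈ Γ.range e ∧ v.1 ∈ Γ.source f}) := by
  by_cases hw : w ∈ Γ.range e
  · have h1 : (Subtype.val : {v // v ≠ w} → Γ.V) ''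
        {v | v.1 ∈ Γ.range e ∨ w ∈ Γ.range e ∧ v.1 ∈ Γ.source f} =
        (Γ.range e \ {w}) ∪ Γ.source f := by
      ext v
      simp only [hw, true_and, Set.mem_image, Set.mem_ofPred_eq, Subtype.exists,
        exists_and_right, exists_eq_right, Set.mem_union, Set.mem_sdiff, Set.mem_singleton_iff]
      constructor
      · rintro ⟨h1, h2 | h2⟩
        exacts [.inl ⟨h2, h1⟩, .inr h2]
      · rintro (⟨h1, h2⟩ | h2)
        exacts [⟨h2, .inl h1⟩, ⟨by rintro rfl; exact h.notMem h2, .inr h2⟩]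
    rw [h1, U.pSum_union ((h.disjoint_range e hw).mono_left Set.sdiff_subset),
      ← U.pSum_sdiff_add hw, mul_add, add_mul, U.transport_mul_pSum_mul_star h (by simp),
      U.transport_mul_p h, ← U.s_mul_star_s_eq_pSum h]
    congr 1
    have h2 := congrArg star (U.transport_mul_p h)
    rw [star_mul, U.star_p] at h2
    conv_lhs => rw [← U.s_mul_p_eq_self h, mul_assoc, h2]
  · have h1 : (Subtype.val : {v // v ≠ w} → Γ.V) ''
        {v | v.1 ∈ Γ.range e ∨ w ∈ Γ.range e ∧ v.1 ∈ Γ.source f} = Γ.range e := by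
      ext v
      simp only [hw, false_and, or_false, Set.mem_image, Set.mem_ofPred_eq, Subtype.exists,
        exists_and_right, exists_eq_right]
      exact ⟨fun h1 => h1.2, fun h1 => ⟨by rintro rfl; exact hw h1, h1⟩⟩
    rw [h1, U.transport_mul_pSum_mul_star h hw]

/-- A family of a hypergraph restricts to one of its backward contraction. -/
noncomputable def contract (h : Γ.IsBackwardContractible f w) :
    Family (Γ.contractBackward f w h.notMem) B :=
  Family.ofMul (Γ := Γ.contractBackward f w h.notMem) (fun v => U.p v.1)
    -- Conjugation replaces `w` by the source of `f` on both sides, and it keeps `s e` self-adjoint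
    -- when the range is empty.
    (fun e => U.transport f w * U.s e.1 * star (U.transport f w))
    (fun v => U.isStarProjection_p v.1)
    (fun v v' hv => U.orthogonal_p _ _ (Subtype.coe_injective.ne hv))
    (fun e he => by
      have h0 : (Γ.range e.1).Nonempty := by
        obtain ⟨v, hv | hv⟩ := he
        exacts [⟨_, hv⟩, ⟨_, hv.1⟩]
      refine Eq.trans ?_ (U.finsum_p_subtype _).symm
      rw [← U.transport_conj_pSum_range h, ← U.star_s_mul_s h0,
        ← U.star_s_mul_transport h e.2 e.2]
      simp only [star_mul, star_star, mul_assoc])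
    (fun e he => by
      have h0 : Γ.range e.1 = ∅ := by
        rw [Set.eq_empty_iff_forall_notMem] at he ⊢
        intro v hv
        by_cases hvw : v = w
        · obtain ⟨v', hv'⟩ := Γ.source_nonempty f
          exact he ⟨v', by rintro rfl; exact h.notMem hv'⟩ (.inr ⟨hvw ▸ hv, hv'⟩)
        · exact he ⟨v, hvw⟩ (.inl hv)
      have h1 := U.star_s_mul_transport h e.2 e.2
      rw [U.star_mul_self_of_empty _ h0] at h1
      conv_rhs => rw [← h1]
      simp only [star_mul, star_star, mul_assoc])
    (fun e e' he => by
      have h1 := U.star_s_mul_transport h e'.2 e.2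
      rw [U.star_mul_of_ne _ _ (Subtype.coe_injective.ne he)] at h1
      simp only [star_mul, star_star, mul_assoc]
      rw [← mul_assoc (U.transport f w) (U.s e'.1), ← mul_assoc (star (U.transport f w)),
        ← mul_assoc (star (U.s e.1)), h1, zero_mul, mul_zero])
    (fun e x hx => by
      have h1 : x * U.transport f w * U.pSum (Γ.source e.1) =
          U.transport f w * U.pSum (Γ.source e.1) := U.mul_pSum_congr fun v hv => by
        rw [mul_assoc]
        by_cases hvw : v = w
        · subst hvw
          rw [U.transport_mul_p h]
          exact U.mul_s_eq_self fun u hu =>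
            hx ⟨u, by rintro rfl; exact h.notMem hu⟩ (.inr ⟨hv, hu⟩)
        · rw [U.transport_mul_p_of_ne h hvw]
          exact hx ⟨v, hvw⟩ (.inl hv)
      rw [← mul_assoc, ← U.pSum_source_mul_s e.1, ← mul_assoc (U.transport f w), ← mul_assoc x,
        ← mul_assoc x, h1])
    (fun v x ⟨e, he⟩ hx => by
      have h1 : ∀ e (hef : e ≠ f), v.1 ∈ Γ.source e ∨ w ∈ Γ.source e ∧ v.1 ∈ Γ.source f →
          x * U.transport f w * U.s e = U.transport f w * U.s e := fun e hef hv => by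
        -- The right factor of the conjugated edge can be cancelled, because `s_mul_transport`
        -- removes the transports in the middle.
        have h2 : U.transport f w * U.s e * star (U.transport f w) *
            (U.transport f w * (star (U.s e) * U.s e)) = U.transport f w * U.s e := by
          rw [← mul_assoc (U.transport f w) (star _), ← mul_assoc, mul_assoc (U.transport f w),
            mul_assoc (U.transport f w), mul_assoc (U.s e), U.s_mul_transport h hef, mul_assoc,
            U.partialIsometry_s]
        rw [mul_assoc, ← h2, ← mul_assoc, hx ⟨e, hef⟩ hv]
      -- A vertex in the source of `f` now emits exactly the edges that started at `w`; its bound is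
      -- the one of `p w`, carried over by `s f`.
      by_cases hvf : v.1 ∈ Γ.source f
      · have hwe : w ∈ Γ.source e.1 := by
          rcases he with he | he
          · exact absurd hvf ((h.disjoint_source e e.2).notMem_of_mem_left he)
          · exact he.1
        have h2 := U.mul_p_congr (v := w) (x := x * U.transport f w) (y := U.transport f w)
          ⟨e.1, hwe⟩ fun e' he' =>
            h1 e' (by rintro rfl; exact h.notMem he') (.inr ⟨he', hvf⟩)
        rw [mul_assoc, U.transport_mul_p h] at h2
        rw [← U.pSum_mul_p_of_mem hvf, ← U.s_mul_star_s_eq_pSum h, ← mul_assoc, ← mul_assoc, h2]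
      · have hve : v.1 ∈ Γ.source e.1 := by
          rcases he with he | he
          exacts [he, absurd he.2 hvf]
        have h2 := U.mul_p_congr (v := v.1) (x := x * U.transport f w) (y := U.transport f w)
          ⟨e.1, hve⟩ fun e' he' => h1 e' (by rintro rfl; exact hvf he') (.inl he')
        rwa [mul_assoc, U.transport_mul_p_of_ne h v.2] at h2)

end Family

end FiniteHypergraph

/-! ### Backward contraction: expanding a family, and injectivity -/

/-- This makes room for a vertex to be added: with the algebra in the upper left corner of 2 by 2
matrices, `g` placed in the lower left entry is a partial isometry onto a projection orthogonal to
the algebra. -/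
theorem exists_partialIsometry_extension (A : Type v) [NonUnitalCStarAlgebra A] {g : A}
    (hg : IsStarProjection g) : ∃ (M : Type v) (_ : NonUnitalCStarAlgebra M) (ι : A →⋆ₙₐ[ℂ] M)
      (m : M), Function.Injective ι ∧ star m * m = ι g ∧ ∀ a, ι a * m = 0 := by
  let _ := CStarAlgebra.spectralOrder A
  have := CStarAlgebra.spectralOrderedRing A
  let ι : A →⋆ₙₐ[ℂ] CStarMatrix (Fin 2) (Fin 2) A :=
    { toFun := fun a => CStarMatrix.ofMatrix !![a, 0; 0, 0]
      map_smul' := fun c a => by ext i j; fin_cases i <;> fin_cases j <;> simp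
      map_zero' := by ext i j; fin_cases i <;> fin_cases j <;> simp
      map_add' := fun a b => by ext i j; fin_cases i <;> fin_cases j <;> simp
      map_mul' := fun a b => by
        ext i j; fin_cases i <;> fin_cases j <;> simp [CStarMatrix.mul_apply]
      map_star' := fun a => by
        ext i j; fin_cases i <;> fin_cases j <;> simp [CStarMatrix.star_apply] }
  refine ⟨CStarMatrix (Fin 2) (Fin 2) A, inferInstance, ι, CStarMatrix.ofMatrix !![0, 0; g, 0],
    fun a b hab => ?_, ?_, fun a => ?_⟩
  · exact congrFun (congrFun hab 0) 0
  · ext i j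
    fin_cases i <;> fin_cases j <;>
      simp [ι, CStarMatrix.mul_apply, CStarMatrix.star_apply, hg.2.star_eq, hg.1.eq]
  · ext i j
    fin_cases i <;> fin_cases j <;> simp [ι, CStarMatrix.mul_apply]

namespace FiniteHypergraph

namespace Family

variable {Γ : FiniteHypergraph.{u}} {f : Γ.E} {w : Γ.V} (h : Γ.IsBackwardContractible f w)
  {M : Type v} [NonUnitalCStarAlgebra M] (U : Family (Γ.contractBackward f w h.notMem) M)

/-- The source of the contracted edge as a set of vertices of the contraction. -/
def contractedSource : Set (Γ.contractBackward f w h.notMem).V := {v | v.1 ∈ Γ.source f}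

/-- The isometry that moves the projection of the contracted source to a new vertex. -/
noncomputable def isometry (m : M) : M := U.pSum (contractedSource h)ᶜ + m

/-- The hypotheses on a partial isometry that turns the projection of the contracted source into the
one of a new vertex. -/
structure IsMover (m : M) : Prop where
  star_mul_eq : star m * m = U.pSum (contractedSource h)
  pSum_mul : U.pSum Set.univ * m = 0

namespace IsMover

variable {h U} {m : M} (hm : IsMover h U m)
include hm

theorem mul_pSum : m * U.pSum (contractedSource h) = m := by
  rw [← hm.star_mul_eq, ← mul_assoc]
  exact IsStarProjection.mul_star_mul_cancel (by
    rw [hm.star_mul_eq]; exact U.isStarProjection_pSum _)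

theorem pSum_mul' (S : Set (Γ.contractBackward f w h.notMem).V) : U.pSum S * m = 0 := by
  rw [← U.pSum_mul_pSum_of_subset' (Set.subset_univ S), mul_assoc, hm.pSum_mul, mul_zero]

theorem p_mul (v : (Γ.contractBackward f w h.notMem).V) : U.p v * m = 0 := by
  rw [← U.pSum_singleton, hm.pSum_mul']

theorem star_mul_pSum (S : Set (Γ.contractBackward f w h.notMem).V) : star m * U.pSum S = 0 := by
  have h1 := congrArg star (hm.pSum_mul' S)
  rwa [star_mul, U.star_pSum, star_zero] at h1

theorem mul_pSum_compl : m * U.pSum (contractedSource h)ᶜ = 0 := by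
  rw [← hm.mul_pSum, mul_assoc, U.pSum_mul_pSum_of_disjoint disjoint_compl_right, mul_zero]

theorem mul_self : m * m = 0 := by
  rw [← hm.mul_pSum, mul_assoc, ← mul_assoc (U.pSum _), hm.pSum_mul', zero_mul, mul_zero]

theorem mul_isometry : m * isometry h U m = 0 := by
  rw [isometry, mul_add, hm.mul_pSum_compl, hm.mul_self, add_zero]

theorem star_isometry_mul_isometry :
    star (isometry h U m) * isometry h U m = U.pSum Set.univ := by
  rw [isometry, star_add, U.star_pSum, add_mul, mul_add, mul_add, U.pSum_mul_self, hm.pSum_mul',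
    hm.star_mul_pSum, hm.star_mul_eq, add_zero, zero_add, ← U.pSum_union disjoint_compl_left,
    Set.compl_union_self]

omit hm in
theorem isometry_mul_p_of_mem {v : (Γ.contractBackward f w h.notMem).V}
    (hv : v.1 ∈ Γ.source f) : isometry h U m * U.p v = m * U.p v := by
  rw [isometry, add_mul, U.pSum_mul_p_of_notMem (show v ∉ (contractedSource h)ᶜ from not_not.2 hv), zero_add]

theorem isometry_mul_p_of_notMem {v : (Γ.contractBackward f w h.notMem).V}
    (hv : v.1 ∉ Γ.source f) : isometry h U m * U.p v = U.p v := by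
  rw [isometry, add_mul, U.pSum_mul_p_of_mem hv, ← hm.mul_pSum, mul_assoc,
    U.pSum_mul_p_of_notMem (show v ∉ contractedSource h from hv), mul_zero, add_zero]

theorem isometry_mul_pSum : isometry h U m * U.pSum (contractedSource h) = m := by
  rw [isometry, add_mul, U.pSum_mul_pSum_of_disjoint disjoint_compl_left, zero_add, hm.mul_pSum]

theorem isometry_mul_pSum_of_disjoint {S : Set (Γ.contractBackward f w h.notMem).V}
    (hS : Disjoint S (contractedSource h)) : isometry h U m * U.pSum S = U.pSum S :=
  U.mul_pSum_eq_self fun v hv =>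
    hm.isometry_mul_p_of_notMem (show v ∉ contractedSource h from hS.notMem_of_mem_left hv)

end IsMover

end Family

namespace Family

variable {Γ : FiniteHypergraph.{u}} {f : Γ.E} {w : Γ.V} (h : Γ.IsBackwardContractible f w)
  {M : Type v} [NonUnitalCStarAlgebra M] (U : Family (Γ.contractBackward f w h.notMem) M)

open Classical in
/-- The vertex projections of the expansion of a family. -/
noncomputable def expandP (m : M) (v : Γ.V) : M :=
  if hv : v = w then m * star m else U.p ⟨v, hv⟩

open Classical in
/-- The partial isometries of the expansion of a family. -/
noncomputable def expandS (m : M) (e : Γ.E) : M :=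
  if he : e = f then star m
  -- The isometry on the left moves the part of the source that came from `w` back to `w`. On the
  -- right it is used when the range contains `w`, or when it is empty and `s e` must remain
  -- self-adjoint. Otherwise vertices of the source of `f` in the range were there already and must
  -- stay.
  else if w ∈ Γ.range e ∨ Γ.range e = ∅ then
    isometry h U m * U.s ⟨e, he⟩ * star (isometry h U m)
  else isometry h U m * U.s ⟨e, he⟩

namespace IsMover

variable {h U} {m : M} (hm : IsMover h U m)
include hm

theorem isometry_mul_star_isometry_mul (x : M) (hx : U.pSum Set.univ * x = x) :
    star (isometry h U m) * (isometry h U m * x) = x := by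
  rw [← mul_assoc, hm.star_isometry_mul_isometry, hx]

/-- The factor on the right can be undone in every case, so left identities may be tested without
it; `exists_expandS` goes the other way. -/
theorem expandS_mul (e : Γ.E) (he : e ≠ f) : ∃ r : M,
    expandS h U m e * r = isometry h U m * U.s ⟨e, he⟩ := by
  unfold expandS
  rw [dif_neg he]
  split_ifs
  · refine ⟨isometry h U m, ?_⟩
    rw [mul_assoc, hm.star_isometry_mul_isometry, mul_assoc, U.s_mul_pSum_univ]
  · exact ⟨U.pSum Set.univ, by rw [mul_assoc, U.s_mul_pSum_univ]⟩

omit hm in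
theorem exists_expandS (e : Γ.E) (he : e ≠ f) : ∃ r : M,
    expandS h U m e = isometry h U m * U.s ⟨e, he⟩ * r := by
  unfold expandS
  rw [dif_neg he]
  split_ifs
  · exact ⟨_, rfl⟩
  · exact ⟨U.pSum Set.univ, by rw [mul_assoc, U.s_mul_pSum_univ]⟩

theorem isStarProjection_expandP (v : Γ.V) : IsStarProjection (expandP h U m v) := by
  unfold expandP
  split_ifs with hv
  · refine isStarProjection_mul_star (IsStarProjection.mul_star_mul_cancel ?_)
    rw [hm.star_mul_eq]
    exact U.isStarProjection_pSum _
  · exact U.isStarProjection_p _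

theorem orthogonal_expandP (v v' : Γ.V) (hv : v ≠ v') : expandP h U m v * expandP h U m v' = 0 := by
  unfold expandP
  split_ifs with h1 h2 h2
  · exact absurd (h1.trans h2.symm) hv
  · rw [mul_assoc, ← U.pSum_singleton, hm.star_mul_pSum, mul_zero]
  · rw [← mul_assoc, hm.p_mul, zero_mul]
  · exact U.orthogonal_p _ _ fun h3 => hv (congrArg Subtype.val h3)

omit hm in
theorem expandP_self : expandP h U m w = m * star m := dif_pos rfl

omit hm in
theorem expandP_of_ne {v : Γ.V} (hv : v ≠ w) : expandP h U m v = U.p ⟨v, hv⟩ := dif_neg hv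

omit hm in
theorem finsum_expandP_of_notMem {S : Set Γ.V} (hS : w ∉ S) :
    ∑ᶠ v ∈ S, expandP h U m v = U.pSum {v | v.1 ∈ S} := by
  have h1 : S = Subtype.val '' {v : {v // v ≠ w} | v.1 ∈ S} := by
    ext v
    simp only [Set.mem_image, Set.mem_ofPred_eq, Subtype.exists, exists_and_right,
      exists_eq_right]
    exact ⟨fun h1 => ⟨by rintro rfl; exact hS h1, h1⟩, fun h1 => h1.2⟩
  conv_lhs => rw [h1]
  rw [finsum_mem_image Subtype.val_injective.injOn]
  exact finsum_mem_congr rfl fun v _ => expandP_of_ne v.2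

omit hm in
theorem finsum_expandP_of_mem {S : Set Γ.V} (hS : w ∈ S) :
    ∑ᶠ v ∈ S, expandP h U m v = m * star m + U.pSum {v | v.1 ∈ S} := by
  have h1 := finsum_mem_insert (expandP h U m) (s := S \ {w}) (fun hi => hi.2 rfl) (Set.toFinite _)
  have h2 : {v : (Γ.contractBackward f w h.notMem).V | v.1 ∈ S \ {w}} = {v | v.1 ∈ S} := by
    ext v
    exact ⟨fun h => h.1, fun h => ⟨h, v.2⟩⟩
  rw [Set.insert_sdiff_singleton, Set.insert_eq_of_mem hS,
    finsum_expandP_of_notMem (S := S \ {w}) (by simp), expandP_self, h2] at h1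
  exact h1

omit hm in
theorem expandS_self : expandS h U m f = star m := dif_pos rfl

/-- The contracted range is the old range without `w`, which the isometry fixes by `disjoint_range`,
together with the source of `f`, which the isometry moves to `m * star m`. -/
theorem star_mul_self_expandS_of_mem (e : Γ.E) (he : e ≠ f) (hw : w ∈ Γ.range e) :
    star (expandS h U m e) * expandS h U m e = ∑ᶠ v ∈ Γ.range e, expandP h U m v := by
  have hdisj : Disjoint {v : (Γ.contractBackward f w h.notMem).V | v.1 ∈ Γ.range e}
      (contractedSource h) :=
    Set.disjoint_left.2 fun v hv hv' => (h.disjoint_range e hw).notMem_of_mem_left hv hv'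
  have h1 : (Γ.contractBackward f w h.notMem).range ⟨e, he⟩ =
      {v | v.1 ∈ Γ.range e} ∪ contractedSource h := by
    ext v
    simp only [hw, true_and, contractedSource]
    rfl
  have h0 : ((Γ.contractBackward f w h.notMem).range ⟨e, he⟩).Nonempty := by
    obtain ⟨v', hv'⟩ := Γ.source_nonempty f
    exact ⟨⟨v', by rintro rfl; exact h.notMem hv'⟩, .inr ⟨hw, hv'⟩⟩
  have h2 : expandS h U m e = isometry h U m * U.s ⟨e, he⟩ * star (isometry h U m) := by
    unfold expandS
    rw [dif_neg he, if_pos (.inl hw)]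
  have h3 := congrArg star (hm.isometry_mul_pSum_of_disjoint hdisj)
  rw [star_mul, U.star_pSum] at h3
  have h4 : m * star (isometry h U m) = m * star m := by
    rw [isometry, star_add, U.star_pSum, mul_add, hm.mul_pSum_compl, zero_add]
  rw [finsum_expandP_of_mem hw, h2, star_mul, star_mul, star_star, mul_assoc, mul_assoc,
    mul_assoc, hm.isometry_mul_star_isometry_mul _ (by rw [← mul_assoc, U.pSum_univ_mul_s]),
    ← mul_assoc (star _), U.star_s_mul_s h0, h1, U.pSum_union hdisj, add_mul, h3, mul_add,
    hm.isometry_mul_pSum_of_disjoint hdisj, ← mul_assoc, hm.isometry_mul_pSum, h4, add_comm]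

theorem star_mul_self_expandS_of_notMem (e : Γ.E) (he : e ≠ f) (hw : w ∉ Γ.range e)
    (h0 : (Γ.range e).Nonempty) :
    star (expandS h U m e) * expandS h U m e = ∑ᶠ v ∈ Γ.range e, expandP h U m v := by
  have h1 : (Γ.contractBackward f w h.notMem).range ⟨e, he⟩ = {v | v.1 ∈ Γ.range e} := by
    ext v
    simp only [hw, false_and, or_false]
  have h2 : expandS h U m e = isometry h U m * U.s ⟨e, he⟩ := by
    unfold expandS
    rw [dif_neg he, if_neg (not_or.2 ⟨hw, h0.ne_empty⟩)]
  have h3 : ((Γ.contractBackward f w h.notMem).range ⟨e, he⟩).Nonempty := by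
    obtain ⟨v, hv⟩ := h0
    exact ⟨⟨v, by rintro rfl; exact hw hv⟩, .inl hv⟩
  rw [finsum_expandP_of_notMem hw, h2, star_mul, mul_assoc,
    hm.isometry_mul_star_isometry_mul _ (U.pSum_univ_mul_s _), U.star_s_mul_s h3, h1]

theorem star_mul_self_expandS_of_empty (e : Γ.E) (he : e ≠ f) (h0 : Γ.range e = ∅) :
    star (expandS h U m e) * expandS h U m e = expandS h U m e := by
  have h1 : (Γ.contractBackward f w h.notMem).range ⟨e, he⟩ = ∅ := by
    ext v
    simp only [h0, Set.mem_empty_iff_false, false_and, or_false]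
    rfl
  have h2 : expandS h U m e = isometry h U m * U.s ⟨e, he⟩ * star (isometry h U m) := by
    unfold expandS
    rw [dif_neg he, if_pos (.inr h0)]
  rw [h2, star_mul, star_mul, star_star, mul_assoc, mul_assoc,
    mul_assoc, hm.isometry_mul_star_isometry_mul _ (by rw [← mul_assoc, U.pSum_univ_mul_s]),
    ← mul_assoc (star _), U.star_mul_self_of_empty _ h1]

theorem star_mul_expandS (e e' : Γ.E) (hee : e ≠ e') :
    star (expandS h U m e) * expandS h U m e' = 0 := by
  by_cases he : e = f
  · have he' : e' ≠ f := by rintro rfl; exact hee he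
    obtain ⟨r, hr⟩ := exists_expandS (h := h) (U := U) (m := m) e' he'
    rw [hr, he, expandS_self, star_star, ← mul_assoc, ← mul_assoc, hm.mul_isometry, zero_mul,
      zero_mul]
  · obtain ⟨r, hr⟩ := exists_expandS (h := h) (U := U) (m := m) e he
    by_cases he' : e' = f
    · rw [hr, he', expandS_self, star_mul, star_mul, mul_assoc, mul_assoc, ← star_mul m,
        hm.mul_isometry, star_zero, mul_zero, mul_zero]
    · obtain ⟨r', hr'⟩ := exists_expandS (h := h) (U := U) (m := m) e' he'
      rw [hr, hr', star_mul, star_mul, mul_assoc, mul_assoc, mul_assoc,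
        hm.isometry_mul_star_isometry_mul _ (by rw [← mul_assoc, U.pSum_univ_mul_s]),
        ← mul_assoc (star (U.s _)), U.star_mul_of_ne _ _ fun h3 => hee (congrArg Subtype.val h3),
        zero_mul, mul_zero]

theorem mul_star_eq {x : M} (hx : x * U.pSum (contractedSource h) = U.pSum (contractedSource h)) :
    x * star m = star m := by
  have h1 := congrArg star hm.mul_pSum
  rw [star_mul, U.star_pSum] at h1
  rw [← h1, ← mul_assoc, hx]

theorem mul_expandS (e : Γ.E) (x : M)
    (hx : ∀ v ∈ Γ.source e, x * expandP h U m v = expandP h U m v) :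
    x * expandS h U m e = expandS h U m e := by
  by_cases he : e = f
  · subst he
    rw [expandS_self]
    refine hm.mul_star_eq (U.mul_pSum_eq_self fun v hv => ?_)
    have h1 := hx v.1 hv
    rwa [expandP_of_ne v.2] at h1
  · obtain ⟨r, hr⟩ := exists_expandS (h := h) (U := U) (m := m) e he
    -- A vertex of the contracted source occurs here only through `w`, where the isometry acts as
    -- `m`; all other vertices are fixed.
    have h1 : x * isometry h U m * U.pSum ((Γ.contractBackward f w h.notMem).source ⟨e, he⟩) =
        isometry h U m * U.pSum ((Γ.contractBackward f w h.notMem).source ⟨e, he⟩) := by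
      refine U.mul_pSum_congr fun v hv => ?_
      rw [mul_assoc]
      by_cases hvf : v.1 ∈ Γ.source f
      · have hwe : w ∈ Γ.source e := by
          rcases hv with hv | hv
          · exact absurd hvf ((h.disjoint_source e he).notMem_of_mem_left hv)
          · exact hv.1
        have h2 := hx w hwe
        rw [expandP_self] at h2
        have h3 : m * star m * (m * U.p v) = m * U.p v := by
          rw [mul_assoc, ← mul_assoc (star m), hm.star_mul_eq, ← mul_assoc, hm.mul_pSum]
        rw [isometry_mul_p_of_mem hvf, ← h3, ← mul_assoc, h2]
      · have hve : v.1 ∈ Γ.source e := by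
          rcases hv with hv | hv
          exacts [hv, absurd hv.2 hvf]
        have h2 := hx v.1 hve
        rw [expandP_of_ne v.2] at h2
        rw [hm.isometry_mul_p_of_notMem hvf, h2]
    rw [hr, ← mul_assoc, ← U.pSum_source_mul_s, ← mul_assoc (isometry h U m), ← mul_assoc x,
      ← mul_assoc x, h1]

theorem mul_expandP (v : Γ.V) (x : M) (hv : ∃ e, v ∈ Γ.source e)
    (hx : ∀ e, v ∈ Γ.source e → x * expandS h U m e = expandS h U m e) :
    x * expandP h U m v = expandP h U m v := by
  have key : ∀ e (he : e ≠ f), v ∈ Γ.source e →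
      x * isometry h U m * U.s ⟨e, he⟩ = isometry h U m * U.s ⟨e, he⟩ := fun e he hve => by
    obtain ⟨r, hr⟩ := hm.expandS_mul e he
    rw [mul_assoc, ← hr, ← mul_assoc, hx e hve]
  by_cases hvf : v ∈ Γ.source f
  · have hvw : v ≠ w := by rintro rfl; exact h.notMem hvf
    have h1 := hx f hvf
    rw [expandS_self] at h1
    have h2 : U.pSum (contractedSource h) * U.p ⟨v, hvw⟩ = U.p ⟨v, hvw⟩ := U.pSum_mul_p_of_mem hvf
    rw [expandP_of_ne hvw, ← h2, ← hm.star_mul_eq, ← mul_assoc, ← mul_assoc, h1]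
  obtain ⟨e, hve⟩ := hv
  have he : e ≠ f := by rintro rfl; exact hvf hve
  by_cases hvw : v = w
  · subst hvw
    rw [expandP_self]
    -- In the contraction, the vertices of the source of `f` emit exactly the edges that started at
    -- `w`, so the hypothesis at `w` reaches all of them.
    have h1 : x * isometry h U m * U.pSum (contractedSource h) =
        isometry h U m * U.pSum (contractedSource h) :=
      U.mul_pSum_congr fun u hu => U.mul_p_congr ⟨⟨e, he⟩, .inr ⟨hve, hu⟩⟩ fun e' he' => by
        refine key e'.1 e'.2 ?_
        rcases he' with he' | he'
        · exact absurd hu ((h.disjoint_source e'.1 e'.2).notMem_of_mem_left he')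
        · exact he'.1
    rw [mul_assoc, hm.isometry_mul_pSum] at h1
    rw [← mul_assoc, h1]
  · rw [expandP_of_ne hvw]
    have h1 := U.mul_p_congr (v := ⟨v, hvw⟩) (x := x * isometry h U m) (y := isometry h U m)
      ⟨⟨e, he⟩, .inl hve⟩ fun e' he' => by
        refine key e'.1 e'.2 ?_
        rcases he' with he' | he'
        exacts [he', absurd he'.2 hvf]
    rwa [mul_assoc, hm.isometry_mul_p_of_notMem hvf] at h1

/-- A family of a backward contraction and a partial isometry from the projection of the contracted
source to a new projection give a family of the original hypergraph. -/
noncomputable def expand : Family Γ M :=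
  Family.ofMul (expandP h U m) (expandS h U m) hm.isStarProjection_expandP hm.orthogonal_expandP
    (fun e h0 => by
      by_cases he : e = f
      · rw [he, expandS_self, star_star, h.range_eq, finsum_mem_singleton, expandP_self]
      · by_cases hw : w ∈ Γ.range e
        · exact hm.star_mul_self_expandS_of_mem e he hw
        · exact hm.star_mul_self_expandS_of_notMem e he hw h0)
    (fun e h0 => hm.star_mul_self_expandS_of_empty e (by
      rintro rfl
      rw [h.range_eq] at h0
      exact Set.singleton_ne_empty w h0) h0)
    hm.star_mul_expandS hm.mul_expandS hm.mul_expandP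

theorem transport_expand : hm.expand.transport f w = star m + U.pSum Set.univ := by
  change expandS h U m f + ∑ᶠ v ∈ ({w}ᶜ : Set Γ.V), expandP h U m v = _
  have h1 : {v : (Γ.contractBackward f w h.notMem).V | v.1 ∈ ({w}ᶜ : Set Γ.V)} = Set.univ :=
    Set.eq_univ_of_forall fun v : {v // v ≠ w} => v.2
  rw [expandS_self, finsum_expandP_of_notMem (by simp), h1]

/-- The transport undoes the isometry on the left. On the right it either undoes it too or acts
trivially, since `s e * m = 0`. -/
theorem contract_expand_s (e : (Γ.contractBackward f w h.notMem).E) :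
    (hm.expand.contract h).s e = U.s e := by
  change hm.expand.transport f w * expandS h U m e.1 * star (hm.expand.transport f w) = U.s e
  have h1 : hm.expand.transport f w * isometry h U m = U.pSum Set.univ := by
    rw [hm.transport_expand, isometry, add_mul, mul_add, mul_add, hm.star_mul_pSum, hm.star_mul_eq,
      hm.pSum_mul, U.pSum_mul_pSum_of_subset (Set.subset_univ _), zero_add, add_zero, add_comm,
      ← U.pSum_union disjoint_compl_left, Set.compl_union_self]
  have h2 := congrArg star h1
  rw [star_mul, U.star_pSum] at h2
  have h3 : U.s e * star (hm.expand.transport f w) = U.s e := by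
    have h4 : U.s e * m = 0 := by
      rw [← U.s_mul_pSum_univ, mul_assoc, hm.pSum_mul, mul_zero]
    rw [hm.transport_expand, star_add, star_star, U.star_pSum, mul_add, U.s_mul_pSum_univ, h4,
      zero_add]
  unfold expandS
  rw [dif_neg e.2]
  split_ifs
  · rw [mul_assoc, mul_assoc, h2, mul_assoc, ← mul_assoc, h1, U.s_mul_pSum_univ,
      U.pSum_univ_mul_s]
  · rw [← mul_assoc, h1, U.pSum_univ_mul_s, h3]

theorem contract_expand_p (v : (Γ.contractBackward f w h.notMem).V) :
    (hm.expand.contract h).p v = U.p v := expandP_of_ne (h := h) v.2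

end IsMover

end Family

variable {Γ : FiniteHypergraph.{u}} {f : Γ.E} {w : Γ.V}

/-- Followed by the lift of the expanded family, the map becomes the embedding into the larger
algebra, as a check on generators shows. -/
theorem contract_lift_injective (h : Γ.IsBackwardContractible f w) :
    Function.Injective (Γ.universalFamily.contract h).lift := by
  set U := (Γ.contractBackward f w h.notMem).universalFamily with hU
  obtain ⟨M, _, ι, m, hι, hm, hm'⟩ := exists_partialIsometry_extension _
    (U.isStarProjection_pSum (Family.contractedSource h))
  have hpS : ∀ S, (U.map ι).pSum S = ι (U.pSum S) := fun S =>
    ((ι : (Γ.contractBackward f w h.notMem).CStar →+ M).map_finsum_mem _ (Set.toFinite S)).symm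
  have hmov : Family.IsMover h (U.map ι) m := ⟨by rw [hpS, hm], by rw [hpS, hm']⟩
  have h1 : hmov.expand.lift.comp (Γ.universalFamily.contract h).lift = ι := by
    refine hom_ext (fun v => ?_) fun e => ?_
    · refine Eq.trans ?_ (hmov.contract_expand_p v)
      change hmov.expand.lift ((Γ.universalFamily.contract h).lift _) = _
      rw [Family.lift_p]
      exact Family.lift_p _ _
    · refine Eq.trans ?_ (hmov.contract_expand_s e)
      change hmov.expand.lift ((Γ.universalFamily.contract h).lift _) = _
      rw [Family.lift_s]
      change hmov.expand.lift (Γ.universalFamily.transport f w * Γ.universalFamily.s e.1 *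
        star (Γ.universalFamily.transport f w)) = hmov.expand.transport f w * hmov.expand.s e.1 *
          star (hmov.expand.transport f w)
      simp only [map_mul, map_star, Family.transport, map_add, Family.lift_s, Family.lift_pSum]
  refine Function.Injective.of_comp (f := hmov.expand.lift) ?_
  have h2 : hmov.expand.lift ∘ (Γ.universalFamily.contract h).lift = ι :=
    congrArg DFunLike.coe h1
  rw [h2]
  exact hι

/-! ### Backward contraction: the range is the corner, and the corner is full -/

/-- The elements whose matrix entries with respect to the two parts of the transport lie in the
C*-algebra of the contraction. -/
noncomputable def contractionEntries (h : Γ.IsBackwardContractible f w) :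
    NonUnitalStarSubalgebra ℂ Γ.CStar :=
  let U := Γ.universalFamily
  let R := NonUnitalStarAlgHom.range (U.contract h).lift
  { carrier := {x | ∀ a ∈ ({U.pSum {w}ᶜ, U.s f} : Set Γ.CStar),
      ∀ b ∈ ({U.pSum {w}ᶜ, U.s f} : Set Γ.CStar), a * x * star b ∈ R}
    add_mem' := fun hx hy a ha b hb => by
      rw [mul_add, add_mul]
      exact add_mem (hx a ha b hb) (hy a ha b hb)
    zero_mem' := fun a _ b _ => by
      rw [mul_zero, zero_mul]
      exact zero_mem _
    mul_mem' := fun {x y} hx hy a ha b hb => by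
      -- The squares `star a * a` of the two test elements are the projections of `{w}ᶜ` and of `w`,
      -- which sum to the unit; entries therefore multiply like matrices.
      have h1 : x = x * star (U.pSum {w}ᶜ) * U.pSum {w}ᶜ + x * star (U.s f) * U.s f := by
        rw [mul_assoc, mul_assoc, U.star_s_mul_s_eq_p h, U.star_pSum, U.pSum_mul_self, ← mul_add,
          Set.compl_eq_univ_sdiff, U.pSum_sdiff_add (Set.mem_univ w), (Γ.one_mul_and_mul_one x).2]
      have h2 : a * (x * y) * star b = a * x * star (U.pSum {w}ᶜ) * (U.pSum {w}ᶜ * y * star b) +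
          a * x * star (U.s f) * (U.s f * y * star b) := by
        conv_lhs => rw [h1]
        simp only [mul_add, add_mul, mul_assoc]
      rw [h2]
      exact add_mem (mul_mem (hx a ha _ (.inl rfl)) (hy _ (.inl rfl) b hb))
        (mul_mem (hx a ha _ (.inr rfl)) (hy _ (.inr rfl) b hb))
    smul_mem' := fun c x hx a ha b hb => by
      rw [mul_smul_comm, smul_mul_assoc]
      exact SMulMemClass.smul_mem c (hx a ha b hb)
    star_mem' := fun {x} hx a ha b hb => by
      have h1 := star_mem (hx b hb a ha)
      rwa [star_mul, star_mul, star_star, ← mul_assoc] at h1 }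

theorem isClosed_contractionEntries (h : Γ.IsBackwardContractible f w) :
    IsClosed (contractionEntries h : Set Γ.CStar) := by
  -- An injective *-homomorphism is isometric, so its range is closed.
  have hR : IsClosed (Set.range (Γ.universalFamily.contract h).lift) :=
    (NonUnitalStarAlgHom.isometry _ (contract_lift_injective h)).isClosedEmbedding.isClosed_range
  have h1 : (contractionEntries h : Set Γ.CStar) =
      ⋂ a ∈ ({Γ.universalFamily.pSum {w}ᶜ, Γ.universalFamily.s f} : Set Γ.CStar),
      ⋂ b ∈ ({Γ.universalFamily.pSum {w}ᶜ, Γ.universalFamily.s f} : Set Γ.CStar),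
        (fun x => a * x * star b) ⁻¹' Set.range (Γ.universalFamily.contract h).lift := by
    ext x
    simp only [Set.mem_iInter]
    rfl
  rw [h1]
  exact isClosed_biInter fun a _ => isClosed_biInter fun b _ =>
    hR.preimage ((continuous_const.mul continuous_id).mul continuous_const)

theorem contract_pSum (h : Γ.IsBackwardContractible f w) {S : Set Γ.V} (hS : w ∉ S) :
    Γ.universalFamily.pSum S ∈ NonUnitalStarAlgHom.range (Γ.universalFamily.contract h).lift := by
  refine ⟨(Γ.contractBackward f w h.notMem).universalFamily.pSum {v | v.1 ∈ S},
    (Family.lift_pSum _ _).trans ((Γ.universalFamily.finsum_p_subtype _).trans ?_)⟩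
  congr 1
  ext v
  simp only [Set.mem_image, Set.mem_ofPred_eq, Subtype.exists, exists_and_right, exists_eq_right]
  exact ⟨fun h1 => h1.2, fun h1 => ⟨by rintro rfl; exact hS h1, h1⟩⟩

-- Only the conjugate of `s e` by the transport, which is the sum of the four entries, is known to
-- lie in the range. The projection of the source of `f` separates the entries: on the left it kills
-- `s e` and keeps `s f * s e`; on the right either `s e * p w = 0`, or `s e` is killed by that
-- projection.
set_option maxHeartbeats 400000 in
theorem s_mem_contractionEntries (h : Γ.IsBackwardContractible f w) {e : Γ.E} (he : e ≠ f) :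
    Γ.universalFamily.s e ∈ contractionEntries h := by
  set U := Γ.universalFamily with hU
  have hzero : (0 : Γ.CStar) ∈ NonUnitalStarAlgHom.range (U.contract h).lift := zero_mem _
  have ht : U.transport f w * U.s e * star (U.transport f w) ∈
      NonUnitalStarAlgHom.range (U.contract h).lift :=
    ⟨_, (U.contract h).lift_s ⟨e, he⟩⟩
  have hge : U.pSum (Γ.source f) * U.s e = 0 :=
    U.pSum_mul_s_of_disjoint (h.disjoint_source e he).symm
  have hgh : U.pSum (Γ.source f) * U.pSum {w}ᶜ = U.pSum (Γ.source f) :=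
    U.pSum_mul_pSum_of_subset' fun v hv => by rintro rfl; exact h.notMem hv
  have hgt : U.pSum (Γ.source f) * (U.transport f w * U.s e) = U.s f * U.s e := by
    rw [Family.transport, add_mul, mul_add, ← mul_assoc, U.pSum_source_mul_s, ← mul_assoc, hgh,
      hge, add_zero]
  have hleft : ∀ a ∈ ({U.pSum {w}ᶜ, U.s f} : Set Γ.CStar),
      a * U.s e * star (U.transport f w) ∈ NonUnitalStarAlgHom.range (U.contract h).lift := by
    have h1 : U.s f * U.s e * star (U.transport f w) ∈
        NonUnitalStarAlgHom.range (U.contract h).lift := by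
      rw [← hgt, mul_assoc]
      exact mul_mem (contract_pSum h h.notMem) ht
    rintro a (rfl | rfl)
    · have h2 : U.pSum {w}ᶜ * U.s e * star (U.transport f w) =
          U.transport f w * U.s e * star (U.transport f w) -
            U.s f * U.s e * star (U.transport f w) := by
        rw [← sub_mul, ← sub_mul, Family.transport, add_sub_cancel_left]
      rw [h2]
      exact sub_mem ht h1
    · exact h1
  have hright : ∀ a ∈ ({U.pSum {w}ᶜ, U.s f} : Set Γ.CStar),
      a * U.s e * star (U.s f) ∈ NonUnitalStarAlgHom.range (U.contract h).lift := by
    intro a ha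
    by_cases hw : w ∉ Γ.range e ∧ (Γ.range e).Nonempty
    · have h1 : U.s e * U.p w = 0 := by
        rw [← U.s_mul_pSum_range hw.2, mul_assoc, U.pSum_mul_p_of_notMem hw.1, mul_zero]
      rw [← U.s_mul_p_eq_self h, star_mul, U.star_p, mul_assoc, ← mul_assoc (U.s e), h1,
        zero_mul, mul_zero]
      exact hzero
    · have h1 : U.s e * U.pSum (Γ.source f) = 0 := by
        refine U.s_mul_pSum_of_disjoint ?_ fun _ => h.disjoint_source e he
        by_cases hw' : w ∈ Γ.range e
        · exact h.disjoint_range e hw'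
        · rw [Set.not_nonempty_iff_eq_empty.1 fun h0 => hw ⟨hw', h0⟩]
          exact Set.empty_disjoint _
      have h2 : star (U.s f) * U.pSum (Γ.source f) = star (U.s f) := by
        have h3 := congrArg star (U.pSum_source_mul_s f)
        rwa [star_mul, U.star_pSum] at h3
      have h3 : U.pSum {w}ᶜ * U.pSum (Γ.source f) = U.pSum (Γ.source f) :=
        U.pSum_mul_pSum_of_subset fun v hv => by rintro rfl; exact h.notMem hv
      have h4 : a * U.s e * star (U.s f) =
          a * U.s e * star (U.transport f w) * U.pSum (Γ.source f) := by
        rw [Family.transport, star_add, U.star_pSum, mul_assoc _ (_ + _), add_mul, h2, h3,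
          mul_add, mul_assoc a, mul_assoc a, h1, mul_zero, add_zero]
      rw [h4]
      exact mul_mem (hleft a ha) (contract_pSum h h.notMem)
  rintro a ha b (rfl | rfl)
  · have h2 : a * U.s e * star (U.pSum {w}ᶜ) =
        a * U.s e * star (U.transport f w) - a * U.s e * star (U.s f) := by
      rw [← mul_sub, Family.transport, star_add, add_sub_cancel_left]
    rw [h2]
    exact sub_mem (hleft a ha) (hright a ha)
  · exact hright a ha

theorem contractionEntries_eq_top (h : Γ.IsBackwardContractible f w) (x : Γ.CStar) :
    x ∈ contractionEntries h := by
  set U := Γ.universalFamily with hU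
  have hg : U.s f * star (U.s f) ∈ NonUnitalStarAlgHom.range (U.contract h).lift := by
    rw [U.s_mul_star_s_eq_pSum h]
    exact contract_pSum h h.notMem
  have hp0 : U.pSum {w}ᶜ * U.p w = 0 := U.pSum_mul_p_of_notMem (by simp)
  have hzero : (0 : Γ.CStar) ∈ NonUnitalStarAlgHom.range (U.contract h).lift := zero_mem _
  have hsh : ∀ x, U.s f * x * star (U.pSum {w}ᶜ) = U.s f * (x * U.pSum {w}ᶜ) := fun x => by
    rw [mul_assoc, U.star_pSum]
  refine mem_of_generators _ (isClosed_contractionEntries h) (fun v => ?_) (fun e => ?_) x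
  · by_cases hv : v = w
    · subst hv
      have h1 : U.p v * U.pSum {v}ᶜ = 0 := U.p_mul_pSum_of_notMem (by simp)
      rintro a (rfl | rfl) b (rfl | rfl)
      · rw [hp0, zero_mul]; exact hzero
      · rw [hp0, zero_mul]; exact hzero
      · rw [hsh, h1, mul_zero]; exact hzero
      · rw [U.s_mul_p_eq_self h]; exact hg
    · have h1 := U.s_mul_p_of_ne h hv
      have h2 := congrArg star h1
      rw [star_mul, star_zero, U.star_p] at h2
      rintro a (rfl | rfl) b (rfl | rfl)
      · rw [U.star_pSum, U.pSum_mul_p_of_mem hv, U.p_mul_pSum_of_mem hv, ← U.pSum_singleton]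
        exact contract_pSum h (Ne.symm hv)
      · rw [mul_assoc, h2, mul_zero]; exact hzero
      · rw [h1, zero_mul]; exact hzero
      · rw [h1, zero_mul]; exact hzero
  · by_cases he : e = f
    · subst he
      have h1 : U.s e * U.s e = 0 := by
        rw [← U.s_mul_p_eq_self h, mul_assoc, ← mul_assoc (U.p w), U.p_mul_s h, zero_mul, mul_zero]
      rintro a (rfl | rfl) b (rfl | rfl)
      · rw [U.pSum_compl_mul_s h, U.star_pSum, U.s_mul_pSum_compl h]; exact hzero
      · rw [U.pSum_compl_mul_s h]; exact hg
      · rw [h1, zero_mul]; exact hzero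
      · rw [h1, zero_mul]; exact hzero
    · exact s_mem_contractionEntries h he

theorem isFullCorner_contractBackward (h : Γ.IsBackwardContractible f w) :
    IsFullCorner (Γ.contractBackward f w h.notMem).CStar Γ.CStar := by
  set U := Γ.universalFamily with hU
  refine ⟨(U.contract h).lift, U.pSum {w}ᶜ, U.isStarProjection_pSum _, contract_lift_injective h,
    fun x => ⟨?_, fun hx => ?_⟩, ?_⟩
  · rintro ⟨y, rfl⟩
    have h1 : (U.contract h).lift
        ((Γ.contractBackward f w h.notMem).universalFamily.pSum Set.univ) = U.pSum {w}ᶜ := by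
      refine (Family.lift_pSum _ _).trans ((U.finsum_p_subtype _).trans ?_)
      congr 1
      ext v
      simp
    rw [← h1, ← map_mul, ← map_mul, (one_mul_and_mul_one _ y).1, (one_mul_and_mul_one _ y).2]
  · rw [← hx]
    have h1 := contractionEntries_eq_top h x _ (.inl rfl) _ (.inl rfl)
    rwa [U.star_pSum] at h1
  · rw [eq_top_iff]
    intro x _
    -- Fullness: the missing projection `p w` equals `star (s f) * P * s f`.
    have h1 : x = x * U.pSum {w}ᶜ * U.pSum {w}ᶜ + x * star (U.s f) * U.pSum {w}ᶜ * U.s f := by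
      rw [mul_assoc _ (U.pSum _) (U.s f), U.pSum_compl_mul_s h, mul_assoc, mul_assoc,
        U.pSum_mul_self, U.star_s_mul_s_eq_p h, ← mul_add,
        Set.compl_eq_univ_sdiff, U.pSum_sdiff_add (Set.mem_univ w), (Γ.one_mul_and_mul_one x).2]
    rw [h1]
    refine add_mem (Submodule.subset_span ⟨x, U.pSum {w}ᶜ, ?_⟩) (Submodule.subset_span ⟨_, _, rfl⟩)
    rw [mul_assoc]

/-! ### The rank and its descent -/

/-- The pairs of different sources that meet. -/
def meetingSources (Γ : FiniteHypergraph.{u}) : Set (Set Γ.V × Set Γ.V) :=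
  {p | p.1 ∈ Set.range Γ.source ∧ p.2 ∈ Set.range Γ.source ∧ p.1 ≠ p.2 ∧ (p.1 ∩ p.2).Nonempty}

/-- The distance of the range from being a single vertex. -/
noncomputable def rangeDefect (Γ : FiniteHypergraph.{u}) (e : Γ.E) : ℕ :=
  -- An empty range counts 1, so that deleting such an edge is progress; only single vertices count
  -- 0.
  open Classical in if Γ.range e = ∅ then 1 else (Γ.range e).ncard - 1

/-- A rank that decreases under suitable normalization steps. -/
noncomputable def rank (Γ : FiniteHypergraph.{u}) : ℕ ×ₗ ℕ ×ₗ ℕ :=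
  -- Meeting pairs come first because separation adds a vertex; vertices precede the defect because
  -- contraction can enlarge ranges.
  toLex (Γ.meetingSources.ncard, toLex (Nat.card Γ.V, ∑ᶠ e, Γ.rangeDefect e))

theorem rank_lt {Γ Δ : FiniteHypergraph.{u}}
    (h : Δ.meetingSources.ncard ≤ Γ.meetingSources.ncard)
    (h' : Nat.card Δ.V < Nat.card Γ.V ∨ Nat.card Δ.V = Nat.card Γ.V ∧
      ∑ᶠ e, Δ.rangeDefect e < ∑ᶠ e, Γ.rangeDefect e) : Δ.rank < Γ.rank := by
  rw [rank, rank, Prod.Lex.toLex_lt_toLex, Prod.Lex.toLex_lt_toLex]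
  rcases h.lt_or_eq with h1 | h1
  exacts [.inl h1, .inr ⟨h1, h'⟩]

theorem finsum_eq_add_finsum_subtype_ne {ι : Type*} [Finite ι] (φ : ι → ℕ) (i : ι) :
    ∑ᶠ j, φ j = φ i + ∑ᶠ j : {j // j ≠ i}, φ j := by
  classical
  let _ : Fintype ι := Fintype.ofFinite ι
  rw [finsum_eq_sum_of_fintype, finsum_eq_sum_of_fintype]
  exact Fintype.sum_eq_add_sum_subtype_ne φ i

theorem rank_deleteEdge_lt (Γ : FiniteHypergraph.{u}) {f : Γ.E} (hf : Γ.range f = ∅) :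
    (Γ.deleteEdge f).rank < Γ.rank := by
  refine rank_lt (Set.ncard_le_ncard ?_ (Set.toFinite _)) (.inr ⟨rfl, ?_⟩)
  · rintro p ⟨⟨e, he⟩, ⟨e', he'⟩, h⟩
    exact ⟨⟨e, he⟩, ⟨e', he'⟩, h⟩
  · rw [finsum_eq_add_finsum_subtype_ne Γ.rangeDefect f, rangeDefect, if_pos hf]
    exact Nat.lt_one_add_iff.2 le_rfl

theorem rank_decomposeRange_lt (Γ : FiniteHypergraph.{u}) {f : Γ.E} (hf : 1 < (Γ.range f).ncard) :
    (Γ.decomposeRange f).rank < Γ.rank := by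
  have hne : (Γ.range f).Nonempty := Set.nonempty_of_ncard_ne_zero (by omega)
  refine rank_lt (Set.ncard_le_ncard ?_ (Set.toFinite _)) (.inr ⟨rfl, ?_⟩)
  · have h1 : Set.range (Γ.decomposeRange f).source ⊆ Set.range Γ.source := by
      rintro _ ⟨e | v, rfl⟩
      exacts [⟨e, rfl⟩, ⟨f, rfl⟩]
    exact fun p h => ⟨h1 h.1, h1 h.2.1, h.2.2⟩
  · rw [finsum_eq_add_finsum_subtype_ne Γ.rangeDefect f]
    have h1 : ∑ᶠ e, (Γ.decomposeRange f).rangeDefect e = ∑ᶠ e : {e // e ≠ f}, Γ.rangeDefect e := by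
      let _ : Fintype {e // e ≠ f} := Fintype.ofFinite _
      let _ : Fintype (Γ.range f) := Fintype.ofFinite _
      rw [finsum_eq_sum_of_fintype (α := {e // e ≠ f} ⊕ Γ.range f), Fintype.sum_sum_type,
        finsum_eq_sum_of_fintype]
      have h2 : ∑ v : Γ.range f, (Γ.decomposeRange f).rangeDefect (Sum.inr v) = 0 :=
        Finset.sum_eq_zero fun v _ => by simp [rangeDefect]
      rw [h2, add_zero]
      rfl
    have h2 : 0 < Γ.rangeDefect f := by
      rw [rangeDefect, if_neg hne.ne_empty]
      omega
    omega

/-- The remaining sources were disjoint from that of `f`. A common vertex of two contracted sources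
is therefore an old common vertex or comes from `w` in both, and no meeting pair is created. -/
theorem rank_contractBackward_lt (Γ : FiniteHypergraph.{u}) {f : Γ.E} {w : Γ.V}
    (h : Γ.IsBackwardContractible f w) : (Γ.contractBackward f w h.notMem).rank < Γ.rank := by
  let c : Set Γ.V → Set {v // v ≠ w} :=
    fun S => {v | v.1 ∈ S ∨ w ∈ S ∧ v.1 ∈ Γ.source f}
  have h1 : (Γ.contractBackward f w h.notMem).meetingSources ⊆
      Prod.map c c '' Γ.meetingSources := by
    rintro ⟨S, T⟩ ⟨⟨e, rfl⟩, ⟨e', rfl⟩, hne, ⟨v, hv, hv'⟩⟩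
    refine ⟨(Γ.source e.1, Γ.source e'.1), ⟨⟨e.1, rfl⟩, ⟨e'.1, rfl⟩, fun h2 => ?_, ?_⟩, rfl⟩
    · exact hne (congrArg c h2)
    · rcases hv with hv | hv <;> rcases hv' with hv' | hv'
      · exact ⟨v.1, hv, hv'⟩
      · exact absurd hv'.2 ((h.disjoint_source e.1 e.2).notMem_of_mem_left hv)
      · exact absurd hv.2 ((h.disjoint_source e'.1 e'.2).notMem_of_mem_left hv')
      · exact ⟨w, hv.1, hv'.1⟩
  refine rank_lt ((Set.ncard_le_ncard h1 (Set.toFinite _)).trans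
    (Set.ncard_image_le (Set.toFinite _))) (.inl ?_)
  exact Finite.card_subtype_lt (x := w) fun h => h rfl

/-- Two sources that share the new vertex are equal, so every meeting pair comes from an old one.
The pair formed by `S` and the source of `e` disappears, because `w` was its only common vertex and
one side loses it. -/
theorem rank_separateSource_lt (Γ : FiniteHypergraph.{u}) {w : Γ.V} {S : Set Γ.V}
    (hS : S ∈ Set.range Γ.source) (hwS : w ∈ S) {e : Γ.E} (hwe : w ∈ Γ.source e)
    (heS : Γ.source e ≠ S) (hinter : Γ.source e ∩ S ⊆ {w}) :
    (Γ.separateSource {e | Γ.source e = S} w).rank < Γ.rank := by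
  let c : Set Γ.V → Set (Option Γ.V) :=
    fun T => {o | o.elim (T = S) fun v => v ∈ T ∧ (T = S → v ≠ w)}
  have h1 : (Γ.separateSource {e | Γ.source e = S} w).meetingSources ⊆
      Prod.map c c '' (Γ.meetingSources \ {(S, Γ.source e)}) := by
    rintro ⟨_, _⟩ ⟨⟨e₁, rfl⟩, ⟨e₂, rfl⟩, hne, ⟨o, ho, ho'⟩⟩
    have hne' : Γ.source e₁ ≠ Γ.source e₂ := fun h2 => hne (congrArg c h2)
    rcases o with _ | v
    · exact absurd (Eq.trans (show Γ.source e₁ = S from ho)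
        (show Γ.source e₂ = S from ho').symm) hne'
    · refine ⟨(Γ.source e₁, Γ.source e₂), ⟨⟨⟨e₁, rfl⟩, ⟨e₂, rfl⟩, hne', ⟨v, ho.1, ho'.1⟩⟩, ?_⟩, rfl⟩
      intro h2
      obtain ⟨h3, h4⟩ := Prod.ext_iff.1 h2
      refine ho.2 h3 (hinter ⟨?_, ?_⟩)
      · rw [← show Γ.source e₂ = Γ.source e from h4]
        exact ho'.1
      · rw [← show Γ.source e₁ = S from h3]
        exact ho.1
  rw [rank, rank, Prod.Lex.toLex_lt_toLex]
  refine .inl ?_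
  refine ((Set.ncard_le_ncard h1 (Set.toFinite _)).trans
    (Set.ncard_image_le (Set.toFinite _))).trans_lt
    (Set.ncard_sdiff_singleton_lt_of_mem ⟨hS, ⟨e, rfl⟩, heS.symm, ⟨w, hwS, hwe⟩⟩ (Set.toFinite _))

/-- A hypergraph that is not normal admits a normalization step that lowers the rank and passes to
a full corner. -/
theorem exists_normalizationStep (Γ : FiniteHypergraph.{u}) (hΓ : ¬ Γ.IsNormal) :
    ∃ Δ : FiniteHypergraph.{u}, Γ.NormalizationStep Δ ∧ IsFullCorner Δ.CStar Γ.CStar ∧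
      Δ.rank < Γ.rank := by
  by_cases h1 : ∀ e, (Γ.range e).encard ≤ 1
  swap
  · push Not at h1
    obtain ⟨f, hf⟩ := h1
    rw [← (Set.toFinite _).cast_ncard_eq] at hf
    have hf' : 1 < (Γ.range f).ncard := by exact_mod_cast hf
    have hne : (Γ.range f).Nonempty := Set.nonempty_of_ncard_ne_zero (by omega)
    exact ⟨_, .inr (.inr (.inl (Γ.rangeDecomposition_decomposeRange hne))),
      Γ.isFullCorner_decomposeRange hne, Γ.rank_decomposeRange_lt hf'⟩
  by_cases h2 : ∀ e, (∃ f, f ≠ e ∧ (Γ.source e ∩ Γ.source f).Nonempty) ∨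
    ((Γ.range e).Nonempty ∧ Γ.range e ⊆ Γ.source e)
  swap
  · push Not at h2
    obtain ⟨f, hf, hf'⟩ := h2
    have hdisj : ∀ e, e ≠ f → Γ.source e ∩ Γ.source f = ∅ := fun e he => by
      rw [Set.inter_comm]
      exact hf e he
    rcases (Γ.range f).eq_empty_or_nonempty with h0 | ⟨w, hw⟩
    · exact ⟨_, .inr (.inr (.inr ⟨f, h0, hdisj, Γ.edgeDeletionAt_deleteEdge f⟩)),
        Γ.isFullCorner_deleteEdge h0 hdisj, Γ.rank_deleteEdge_lt h0⟩
    -- All ranges have at most one vertex at this stage, which supplies the range condition of the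
    -- contraction.
    · have hrange : ∀ e, w ∈ Γ.range e → Γ.range e = {w} := fun e he =>
        (Set.encard_le_one_iff_subsingleton.1 (h1 e)).eq_singleton_of_mem he
      have hws : w ∉ Γ.source f := fun h =>
        hf' ⟨w, hw⟩ (by rw [hrange f hw]; exact Set.singleton_subset_iff.2 h)
      have h : Γ.IsBackwardContractible f w :=
        ⟨hrange f hw, fun e he => Set.disjoint_iff_inter_eq_empty.2 (hdisj e he), fun e he => by
          rw [hrange e he]
          exact Set.disjoint_singleton_left.2 hws⟩
      exact ⟨_, .inr (.inl (Γ.backwardContraction_contractBackward h)),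
        isFullCorner_contractBackward h, Γ.rank_contractBackward_lt h⟩
  have h3 : ¬ ∀ e f, e ≠ f → (Γ.source e ∩ Γ.source f).encard = 1 →
      ((Γ.source e).encard = 1 ∧ (Γ.source f).encard = 1) ∨
        ∃ g, g ≠ e ∧ Γ.source e ∩ Γ.source f ⊂ Γ.source e ∩ Γ.source g :=
    fun h3 => hΓ ⟨h1, h2, h3⟩
  push Not at h3
  obtain ⟨e, f, hef, hw, hone, hmax⟩ := h3
  obtain ⟨w, hw⟩ := Set.encard_eq_one.1 hw
  have hwef : w ∈ Γ.source e ∩ Γ.source f := by rw [hw]; rfl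
  -- Equal sources would both be `{w}`, which the first alternative of the third condition allows.
  have hfS : Γ.source f ≠ Γ.source e := fun h => by
    rw [h, Set.inter_self] at hw
    exact hone (by rw [hw, Set.encard_singleton]) (by rw [h, hw, Set.encard_singleton])
  -- A second common vertex would make the intersection with the source of `e` strictly larger than
  -- `{w}`, against the failure of the third condition.
  have hother : ∀ g, Γ.source g ≠ Γ.source e → w ∈ Γ.source g →
      Γ.source g ∩ Γ.source e ⊆ {w} := fun g hg hwg => by
    have h4 := hmax g (by rintro rfl; exact hg rfl)
    rw [hw] at h4
    intro v hv
    by_contra hvw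
    exact h4 ⟨Set.singleton_subset_iff.2 ⟨hwef.1, hwg⟩, fun h5 => hvw (h5 ⟨hv.2, hv.1⟩)⟩
  -- All edges with the source of `e` are separated together: parallel edges stay parallel, as suits
  -- a rank that counts sources and not edges.
  refine ⟨Γ.separateSource {g | Γ.source g = Γ.source e} w,
    .inl (Γ.sourceSeparation_separateSource ⟨e, rfl⟩ ⟨fun g hg => ?_, fun h4 => hfS (h4 hwef.2)⟩),
    Γ.isFullCorner_separateSource (S := Γ.source e) hwef.1 (fun g hg => ?_) ⟨e, rfl⟩
      (fun g hg hwg => hother g hg hwg) ⟨f, hfS, hwef.2⟩,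
    Γ.rank_separateSource_lt ⟨e, rfl⟩ hwef.1 hwef.2 hfS (hother f hfS hwef.2)⟩
  · rw [Set.mem_ofPred_eq, show Γ.source g = Γ.source e from hg]
    exact hwef.1
  · rw [show Γ.source g = Γ.source e from hg]
    exact ⟨hwef.1, subset_rfl⟩

theorem exists_isNormal (Γ : FiniteHypergraph.{u}) :
    ∃ Δ : FiniteHypergraph.{u}, Δ.IsNormal ∧ Relation.ReflTransGen NormalizationStep Γ Δ ∧
      IsFullCorner Δ.CStar Γ.CStar := by
  induction hr : Γ.rank using WellFoundedLT.induction generalizing Γ with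
  | ind r ih =>
    by_cases hΓ : Γ.IsNormal
    · exact ⟨Γ, hΓ, .refl, Γ.isFullCorner_refl⟩
    · obtain ⟨Δ, h1, h2, h3⟩ := Γ.exists_normalizationStep hΓ
      obtain ⟨Δ', h4, h5, h6⟩ := ih _ (hr ▸ h3) Δ rfl
      exact ⟨Δ', h4, .head h1 h5, h6.trans h2⟩

theorem NormalizationStep.minorStep {Γ Δ : FiniteHypergraph.{u}} (h : Γ.NormalizationStep Δ) :
    Γ.MinorStep Δ := by
  rcases h with h | h | h | ⟨f, _, _, h⟩
  · exact .inr (.inr (.inr (.inr (.inr (.inl h)))))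
  · exact .inr (.inr (.inr (.inl h)))
  · exact .inr (.inr (.inr (.inr (.inr (.inr h)))))
  · exact .inr (.inl ⟨f, h⟩)

end FiniteHypergraph

theorem lemma4p2 (Γ : FiniteHypergraph.{u}) :
    ∃ Δ : FiniteHypergraph.{u},
      Δ.IsNormal ∧
      Relation.ReflTransGen FiniteHypergraph.NormalizationStep Γ Δ ∧
      Δ.IsMinor Γ ∧
      IsCStarMoritaEquivalent Δ.CStar Γ.CStar := by
  obtain ⟨Δ, h1, h2, h3⟩ := Γ.exists_isNormal
  exact ⟨Δ, h1, h2, Relation.ReflTransGen.mono (fun _ _ h => h.minorStep) _ _ h2, h3.isCStarMoritaEquivalent⟩
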